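/- Let $d,n\ge 1$, let $\Omega\subset\mathbb R^d$ be open and bounded, let $\square=[0,1)^d$, and let $T$ be $\square$ with the topology of the $d$-dimensional torus. Let $\rho_1,\dots,\rho_n$ be positive functions of $\varepsilon>0$ with $\rho_k(\varepsilon)\to0$ as $\varepsilon\to0^+$ for every $k$ and $\rho_{k+1}(\varepsilon)/\rho_k(\varepsilon)\to0$ as $\varepsilon\to0^+$ for $1\le k\le n-1$. Fix a sequence $\varepsilon_h>0$ with $\varepsilon_h\to0$ and put $$v_h(x)=\Bigl(\bigl\langle \tfrac{x}{\rho_1(\varepsilon_h)}\bigr\rangle,\dots,\bigl\langle \tfrac{x}{\rho_n(\varepsilon_h)}\bigr\rangle\Bigr)\in\square^n ,$$ where $\langle\cdot\rangle$ is the componentwise fractional part. *Young measures.* For a measurable set $D$ and a locally compact, complete, separable metric space $S$, let $\mathcal Y(D,S)$ be the set of maps $x\mapsto\mu_x$ from $D$ to the Borel measures on $S$ such that $x\mapsto\int_S\phi\,d\mu_x$ is Lebesgue measurable for each $\phi\in C_0(S)$ and $\mu_x$ is a probability measure for a.e. $x$. For $\mu\in\mathcal Y(D,S)$ let $\widehat\mu(A)=\int_D\mu_x(\{s:(x,s)\in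 A\})\,dx$ for Borel $A\subseteq D\times S$. A sequence of measurable maps $w_h:D\to S$ generates $\mu\in\mathcal Y(D,S)$ if $\int_D\Phi_x(w_h(x))\,dx\to\int_D\int_S\Phi_x\,d\mu_x\,dx$ for all $\Phi\in L^1(D,C_0(S))$. A sequence $u_h:\Omega\to\mathbb R$ generates the multiscale Young measure $\nu\in\mathcal Y(\Omega\times\square^n,\mathbb R)$ if the maps $w_h=(v_h,u_h):\Omega\to T^n\times\mathbb R$ generate some $\mu\in\mathcal Y(\Omega,T^n\times\mathbb R)$ with $\widehat\mu=\widehat\nu$ (identifying $\square^n$ with $T^n$). Its barycenter is $\overline\nu(x,y)=\int_{\mathbb R}z\,d\nu_{(x,y)}(z)$. *Admissible functions.* A function $\psi:\Omega\times\square^n\to\mathbb R$ is admissible if for every $\delta>0$ there are compact sets $X\subseteq\Omega$ and $Y\subseteq\square$ with $|\Omega\setminus X|\le\delta$, $|\square\setminus Y|\le\delta$ and $\psi|_{X\times Y^n}$ continuous. It is $r$-admissible if moreover there is a positive $\alpha\in L^r(\Omega)$ with $|\psi(x,y)|\le\alpha(x)$ for all $(x,y)\in\Omega\times\square^n$. **Theorem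 4.1.** (a) Let $q\in(1,\infty]$, let $\frac1q+\frac1{q'}=1$, let $u_h$ be a bounded sequence in $L^q(\Omega)$ which generates a multiscale Young measure $\nu$, and let $\psi$ be $q'$-admissible. Then every $\psi(\cdot,v_h(\cdot))\,u_h$ is integrable on $\Omega$, $\overline\nu(x,y)$ is well defined (i.e. $\int_{\mathbb R}|z|\,d\nu_{(x,y)}(z)<\infty$) for a.e. $(x,y)\in\Omega\times\square^n$, $\psi\,\overline\nu$ is integrable on $\Omega\times\square^n$, and $$\lim_{h\to\infty}\int_\Omega\psi(x,v_h(x))\,u_h(x)\,dx=\int_{\Omega\times\square^n}\psi(x,y)\,\overline\nu(x,y)\,dx\,dy .$$ (b) In particular (taking $u_h\equiv1$), for every $r\in[1,\infty]$ and every $r$-admissible $\psi$, the functions $\psi(\cdot,v_h(\cdot))$ and $\psi$ are integrable on $\Omega$ and on $\Omega\times\square^n$ respectively, and $$\lim_{h\to\infty}\int_\Omega\psi(x,v_h(x))\,dx=\int_{\Omega\times\square^n}\psi(x,y)\,dx\,dy .$$ -/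

import Mathlib

open Set Filter Topology MeasureTheory
open scoped ENNReal ZeroAtInfty

/-! ### Young measures -/

section YoungMeasures

variable {X S : Type*} [MeasurableSpace X]
  [TopologicalSpace S] [MeasurableSpace S]

/-- The family `𝒴(D, S)`, where `m` is Lebesgue measure on `D`: maps `x ↦ μ x` with values in the
measures on `S` which are weak* measurable, i.e. `x ↦ ⟨μ x, φ⟩` is (Lebesgue) measurable for
every `φ ∈ C₀(S)`, and such that `μ x` is a probability measure for almost every `x`. -/
structure IsYoungFamily (m : Measure X) (μ : X → Measure S) : Prop where
  weakStarMeasurable : ∀ φ : C₀(S, ℝ), AEMeasurable (fun x => ∫ s, φ s ∂(μ x)) m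
  isProbability : ∀ᵐ x ∂m, IsProbabilityMeasure (μ x)

/-- `μ ∈ 𝒴(D, S)` is the Young measure generated by the sequence `w h : D → S`:
`δ_{w h}` converges to `μ` weakly* in the dual `L^∞_w(D, ℳ(S))` of `L¹(D, C₀(S))`. -/
structure GeneratesYoungMeasure (m : Measure X) (w : ℕ → X → S) (μ : X → Measure S) : Prop where
  isYoungFamily : IsYoungFamily m μ
  tendsto : ∀ Φ : X → C₀(S, ℝ), Integrable Φ m →
    Tendsto (fun h => ∫ x, Φ x (w h x) ∂m) atTop (𝓝 (∫ x, (∫ s, Φ x s ∂(μ x)) ∂m))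

/-- The measure `μ̂(A) = ∫_D (∫_S χ_A(x, s) dμ_x(s)) dx` on `D × S` attached to `μ ∈ 𝒴(D, S)`,
given through its values on (measurable) sets. -/
noncomputable def youngHat (m : Measure X) (μ : X → Measure S) (A : Set (X × S)) : ℝ≥0∞ :=
  ∫⁻ x, μ x {s | (x, s) ∈ A} ∂m

end YoungMeasures

/-! ### The unit cell, the torus and the oscillating variables

`ℝᵈ` is `Fin d → ℝ`; only its topology, its bounded sets and Lebesgue measure are used. -/

/-- The unit cell `□ = [0,1)ᵈ`. -/
def unitCell (d : ℕ) : Set (Fin d → ℝ) := Set.pi univ fun _ => Ico (0 : ℝ) 1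

/-- The power `□ⁿ`. -/
def unitCellPow (n d : ℕ) : Set (Fin n → Fin d → ℝ) := Set.pi univ fun _ => unitCell d

/-- The power `Tⁿ` of the `d`-dimensional torus `T`. -/
abbrev TorusPow (n d : ℕ) : Type := Fin n → Fin d → UnitAddCircle

/-- The `σ`-algebra on `Tⁿ` is the Borel one. -/
instance instBorelSpaceTorusPow (n d : ℕ) : BorelSpace (TorusPow n d) :=
  haveI : BorelSpace (Fin d → UnitAddCircle) := inferInstance
  haveI : SecondCountableTopology (Fin d → UnitAddCircle) := inferInstance
  Pi.borelSpace

/-- The identification of `□ⁿ` with `Tⁿ` (a bijection on `□ⁿ`). -/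
def toTorus {n d : ℕ} (y : Fin n → Fin d → ℝ) : TorusPow n d :=
  fun k i => ((y k i : ℝ) : UnitAddCircle)

/-- Lebesgue measure on `Ω × □ⁿ`. -/
noncomputable def macroMicro {d : ℕ} (n : ℕ) (Ω : Set (Fin d → ℝ)) :
    Measure ((Fin d → ℝ) × (Fin n → Fin d → ℝ)) :=
  volume.restrict (Ω ×ˢ unitCellPow n d)

/-- Length scales: positive functions `ρ₁, …, ρₙ` of `t > 0` which converge to `0` as `t → 0⁺`
and are separated, i.e. `ρₖ₊₁(t) / ρₖ(t) → 0` as `t → 0⁺` for `k = 1, …, n - 1`. -/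
structure IsScaleFamily {n : ℕ} (ρ : Fin n → ℝ → ℝ) : Prop where
  pos : ∀ k t, 0 < t → 0 < ρ k t
  tendsto_zero : ∀ k, Tendsto (ρ k) (𝓝[>] 0) (𝓝 0)
  separated : ∀ (k : ℕ) (hk : k + 1 < n),
    Tendsto (fun t => ρ ⟨k + 1, hk⟩ t / ρ ⟨k, Nat.lt_of_succ_lt hk⟩ t) (𝓝[>] 0) (𝓝 0)

/-- `v_h(x) = (⟨x / ρ₁(ε_h)⟩, …, ⟨x / ρₙ(ε_h)⟩) ∈ □ⁿ`, with `⟨·⟩` the componentwise fractional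
part. -/
noncomputable def oscVar {n d : ℕ} (ρ : Fin n → ℝ → ℝ) (ε : ℕ → ℝ) (h : ℕ) (x : Fin d → ℝ) :
    Fin n → Fin d → ℝ :=
  fun k i => Int.fract (x i / ρ k (ε h))

/-- `w_h(x) = (v_h(x), u_h(x))`, as an element of `Tⁿ × ℝ`. -/
noncomputable def oscPair {n d : ℕ} (ρ : Fin n → ℝ → ℝ) (ε : ℕ → ℝ)
    (u : ℕ → (Fin d → ℝ) → ℝ) (h : ℕ) (x : Fin d → ℝ) : TorusPow n d × ℝ :=
  (toTorus (oscVar ρ ε h x), u h x)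

/-! ### Multiscale Young measures -/

/-- `ν ∈ 𝒴(Ω × □ⁿ, ℝ)` is the multiscale Young measure generated by `u`: the sequence `w_h`
generates a Young measure `μ ∈ 𝒴(Ω, Tⁿ × ℝ)`, and the measures `μ̂` on `Ω × (Tⁿ × ℝ)` and `ν̂`
on `(Ω × □ⁿ) × ℝ` coincide (under the identification of `□ⁿ` with `Tⁿ`). -/
def GeneratesMultiscaleYoungMeasure {n d : ℕ} (Ω : Set (Fin d → ℝ)) (ρ : Fin n → ℝ → ℝ)
    (ε : ℕ → ℝ) (u : ℕ → (Fin d → ℝ) → ℝ)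
    (ν : (Fin d → ℝ) × (Fin n → Fin d → ℝ) → Measure ℝ) : Prop :=
  IsYoungFamily (macroMicro n Ω) ν ∧
  ∃ μ : (Fin d → ℝ) → Measure (TorusPow n d × ℝ),
    GeneratesYoungMeasure (volume.restrict Ω) (oscPair ρ ε u) μ ∧
    ∀ A : Set ((Fin d → ℝ) × (TorusPow n d × ℝ)), MeasurableSet A →
      youngHat (volume.restrict Ω) μ A =
        youngHat (macroMicro n Ω) ν {p | (p.1.1, (toTorus p.1.2, p.2)) ∈ A}

/-- The barycenter (center of mass) `ν̄(x, y) = ∫_ℝ z dν_{(x,y)}(z)`. -/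
noncomputable def barycenter {n d : ℕ} (ν : (Fin d → ℝ) × (Fin n → Fin d → ℝ) → Measure ℝ)
    (p : (Fin d → ℝ) × (Fin n → Fin d → ℝ)) : ℝ :=
  ∫ z, z ∂(ν p)

/-! ### Admissible functions -/

/-- Admissible functions `ψ : Ω × □ⁿ → ℝ`; only the values on `Ω × □ⁿ` matter. -/
def IsAdmissible {n d : ℕ} (Ω : Set (Fin d → ℝ))
    (ψ : (Fin d → ℝ) → (Fin n → Fin d → ℝ) → ℝ) : Prop :=
  ∀ δ : ℝ, 0 < δ → ∃ (X Y : Set (Fin d → ℝ)),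
    IsCompact X ∧ X ⊆ Ω ∧ volume (Ω \ X) ≤ ENNReal.ofReal δ ∧
    IsCompact Y ∧ Y ⊆ unitCell d ∧ volume (unitCell d \ Y) ≤ ENNReal.ofReal δ ∧
    ContinuousOn (fun p : (Fin d → ℝ) × (Fin n → Fin d → ℝ) => ψ p.1 p.2)
      (X ×ˢ Set.pi univ fun _ : Fin n => Y)

/-- The class `𝒜dm^r` of `r`-admissible functions. -/
def IsAdm {n d : ℕ} (r : ℝ≥0∞) (Ω : Set (Fin d → ℝ))
    (ψ : (Fin d → ℝ) → (Fin n → Fin d → ℝ) → ℝ) : Prop :=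
  IsAdmissible Ω ψ ∧
  ∃ α : (Fin d → ℝ) → ℝ, MemLp α r (volume.restrict Ω) ∧ (∀ x ∈ Ω, 0 < α x) ∧
    ∀ x ∈ Ω, ∀ y ∈ unitCellPow n d, |ψ x y| ≤ α x

/-! Everything is read off measures on triples ((x, y), z): the law `Qs h` of (x, v_h(x), u_h(x))
for x in Ω, and the measure `Q`, which is Lebesgue measure on Ω × □ⁿ with z distributed according to
ν. Generation of ν yields convergence of the integrals of c(x, y) g(z) with c in L¹(Ω, C(Tⁿ)) and g
in C_c(ℝ) (`TestConvergence`). This has to be extended to ψ(x, y) z, although ψ may be discontinuous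
and the graph of v_h is a null set.

Discontinuity is controlled by marginals (`HasSpreadMarginals`). Under all these measures x has
bounded density on Ω and each single y_k has bounded density on □, with one constant, because
⟨x/ρ_k⟩ sweeps out cells of side ρ_k. Triples outside X × Yⁿ therefore have mass at most C(n + 1)δ
under all the measures at once; this is what the product form of admissibility provides. On X × Yⁿ
the function ψ is continuous, and since □ injects into T it extends by Tietze to ℝᵈ × Tⁿ. Bounded
admissible functions are thus approximated by test functions uniformly over the measures
(`exists_approx_of_bounded`).

Unboundedness is controlled by uniform integrability: q > 1 gives q' < ∞, so Hölder's inequality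
makes the tails of α(x)|z| small uniformly in h, while integrability under `Q` comes from Fatou's
lemma. Truncating ψ and z then permits an interchange of limits
(`TestConvergence.tendsto_integral_mul`), and Fubini for kernels turns z into the barycenter.

For (b) the constant sequence 1 must generate the Dirac mass at 1, which amounts to equidistribution
of v_h in Tⁿ over sets of finite measure. By Weyl's method it suffices to test nontrivial
characters. Along v_h these are plane waves in x, whose frequencies diverge because the finest scale
present dominates, so the Riemann–Lebesgue lemma applies. Then (a) is used with q = ∞ and q' = 1. -/

section MultiscaleYoungMeasures

open ProbabilityTheory

/-! ### Cutoff functions on the line. -/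

section Cutoff

/-- A continuous plateau function on `ℝ`: it is `1` for `|z| ≤ R` and `0` for `R + 1 ≤ |z|`. -/
noncomputable def plateau (R z : ℝ) : ℝ := max 0 (min 1 (R + 1 - |z|))

lemma continuous_plateau (R : ℝ) : Continuous (plateau R) := by
  unfold plateau; fun_prop

lemma plateau_nonneg (R z : ℝ) : 0 ≤ plateau R z := le_max_left _ _

lemma plateau_le_one (R z : ℝ) : plateau R z ≤ 1 :=
  max_le zero_le_one (min_le_left _ _)

lemma plateau_eq_one {R z : ℝ} (h : |z| ≤ R) : plateau R z = 1 := by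
  unfold plateau
  rw [min_eq_left (by linarith), max_eq_right zero_le_one]

lemma plateau_eq_zero {R z : ℝ} (h : R + 1 ≤ |z|) : plateau R z = 0 := by
  unfold plateau
  exact max_eq_left ((min_le_right _ _).trans (by linarith))

lemma eventually_plateau_eq_one (z : ℝ) : ∀ᶠ j : ℕ in atTop, plateau j z = 1 := by
  filter_upwards [eventually_ge_atTop ⌈|z|⌉₊] with j hj
  exact plateau_eq_one ((Nat.le_ceil _).trans (by exact_mod_cast hj))

end Cutoff

/-! ### From weak* measurable families to Markov kernels. -/

section YoungKernel

variable {X S : Type*} [MeasurableSpace X] [PseudoMetricSpace S] [ProperSpace S]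
  [MeasurableSpace S] [BorelSpace S] {m : Measure X} {μ : X → Measure S}

/-- Weak* measurability only concerns functions vanishing at infinity. The indicator of F is the
pointwise limit of its continuous outer approximations multiplied by a plateau in the distance to a
base point; properness makes these products compactly supported. -/
lemma IsYoungFamily.aemeasurable_measure_isClosed (h : IsYoungFamily m μ) {F : Set S}
    (hF : IsClosed F) : AEMeasurable (fun x => μ x F) m := by
  rcases isEmpty_or_nonempty S with hS | ⟨⟨s₀⟩⟩
  · have : F = ∅ := Subsingleton.elim _ _
    simp [this]
  let φ : ℕ → C₀(S, ℝ) := fun n =>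
    { toFun := fun s => (hF.apprSeq n s : ℝ) * plateau n (dist s s₀)
      continuous_toFun := by
        have := continuous_plateau n
        fun_prop
      zero_at_infty' := by
        apply HasCompactSupport.is_zero_at_infty
        refine HasCompactSupport.intro (isCompact_closedBall s₀ (n + 1)) fun s hs => ?_
        rw [plateau_eq_zero, mul_zero]
        rw [Metric.mem_closedBall, not_le] at hs
        exact hs.le.trans (le_abs_self _) }
  have hφ : ∀ n s, φ n s = (hF.apprSeq n s : ℝ) * plateau n (dist s s₀) := fun _ _ => rfl
  have hle : ∀ n s, (hF.apprSeq n s : ℝ) ≤ 1 := fun n s => by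
    exact_mod_cast HasOuterApproxClosed.apprSeq_apply_le_one hF n s
  have hlim : ∀ s, Tendsto (fun n => φ n s) atTop (𝓝 (F.indicator (fun _ => (1 : ℝ)) s)) := by
    intro s
    have h1 := (tendsto_pi_nhds.1 (HasOuterApproxClosed.tendsto_apprSeq hF)) s
    have h2 : Tendsto (fun n => (hF.apprSeq n s : ℝ)) atTop
        (𝓝 (F.indicator (fun _ => (1 : ℝ)) s)) := by
      have := (NNReal.continuous_coe.tendsto _).comp h1
      have hcoe : ((F.indicator (fun _ => (1 : NNReal)) s : NNReal) : ℝ)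
          = F.indicator (fun _ => (1 : ℝ)) s := by by_cases hs : s ∈ F <;> simp [hs]
      rwa [hcoe] at this
    refine h2.congr' ?_
    filter_upwards [eventually_plateau_eq_one (dist s s₀)] with n hn
    rw [hφ, hn, mul_one]
  have hreal : AEMeasurable (fun x => (μ x).real F) m := by
    refine aemeasurable_of_tendsto_metrizable_ae atTop
      (f := fun n x => ∫ s, φ n s ∂(μ x)) (fun n => h.weakStarMeasurable (φ n)) ?_
    filter_upwards [h.isProbability] with x hx
    have hint : (μ x).real F = ∫ s, F.indicator (fun _ => (1 : ℝ)) s ∂(μ x) := by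
      rw [integral_indicator hF.measurableSet]; simp
    rw [hint]
    refine tendsto_integral_of_dominated_convergence (fun _ => 1)
      (fun n => (φ n).continuous.aestronglyMeasurable) (integrable_const _)
      (fun n => Eventually.of_forall fun s => ?_) (Eventually.of_forall hlim)
    rw [hφ, Real.norm_eq_abs, abs_mul, abs_of_nonneg (plateau_nonneg _ _),
      abs_of_nonneg (NNReal.coe_nonneg _)]
    exact mul_le_one₀ (hle n s) (plateau_nonneg _ _) (plateau_le_one _ _)
  refine hreal.ennreal_ofReal.congr ?_
  filter_upwards [h.isProbability] with x hx
  simp [Measure.real]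

/-- A Young family is almost everywhere equal to a Markov kernel. -/
lemma IsYoungFamily.exists_kernel [SecondCountableTopology S] [Nonempty S]
    (h : IsYoungFamily m μ) :
    ∃ κ : Kernel X S, IsMarkovKernel κ ∧ ∀ᵐ x ∂m, κ x = μ x := by
  classical
  -- Finite intersections of a countable basis form a countable π-system that generates the Borel
  -- sets. Countability lets all the identities `μ x U = f U x` hold off a single null set `G`, on
  -- which μ is replaced by a Dirac mass.
  let B : Set (Set S) := (fun f => ⋂₀ f) '' {f : Set (Set S) | f.Finite ∧
    f ⊆ TopologicalSpace.countableBasis S}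
  have hB : TopologicalSpace.IsTopologicalBasis B :=
    TopologicalSpace.isTopologicalBasis_of_subbasis
      (TopologicalSpace.isBasis_countableBasis S).eq_generateFrom
  have hBc : B.Countable :=
    (countable_ofPred_finite_subset (TopologicalSpace.countable_countableBasis S)).image _
  have hBpi : IsPiSystem B := by
    rintro _ ⟨f, ⟨hf, hf'⟩, rfl⟩ _ ⟨g, ⟨hg, hg'⟩, rfl⟩ -
    exact ⟨f ∪ g, ⟨hf.union hg, union_subset hf' hg'⟩, sInter_union f g⟩
  have hmeas : ∀ U ∈ B, AEMeasurable (fun x => μ x U) m := by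
    intro U hU
    have hUo := hB.isOpen hU
    refine ((h.aemeasurable_measure_isClosed hUo.isClosed_compl).const_sub 1).congr ?_
    filter_upwards [h.isProbability] with x hx
    rw [prob_compl_eq_one_sub hUo.measurableSet, ENNReal.sub_sub_cancel ENNReal.one_ne_top
      prob_le_one]
  choose! f hf hfe using hmeas
  have hall : ∀ᵐ x ∂m, IsProbabilityMeasure (μ x) ∧ ∀ U ∈ B, μ x U = f U x :=
    h.isProbability.and ((ae_ball_iff hBc).2 fun U hU => hfe U hU)
  obtain ⟨G, hGsub, hGm, hG0⟩ := exists_measurable_superset_of_null (ae_iff.1 hall)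
  obtain ⟨s₀⟩ := ‹Nonempty S›
  have hgood : ∀ x, x ∉ G → IsProbabilityMeasure (μ x) ∧ ∀ U ∈ B, μ x U = f U x := by
    intro x hx
    by_contra hcon
    exact hx (hGsub hcon)
  let κ₀ : X → Measure S := fun x => if x ∈ G then Measure.dirac s₀ else μ x
  have hprob : ∀ x, IsProbabilityMeasure (κ₀ x) := by
    intro x
    by_cases hx : x ∈ G
    · simp only [κ₀, hx, if_true]; infer_instance
    · simp only [κ₀, hx, if_false]; exact (hgood x hx).1
  have hκ₀ : Measurable κ₀ := by
    refine Measurable.measure_of_isPiSystem_of_isProbabilityMeasure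
      (hB.borel_eq_generateFrom ▸ BorelSpace.measurable_eq) hBpi fun U hU => ?_
    have : (fun x => κ₀ x U) = G.piecewise (fun _ => Measure.dirac s₀ U) (f U) := by
      ext x
      by_cases hx : x ∈ G
      · simp [κ₀, hx]
      · simp [κ₀, hx, (hgood x hx).2 U hU]
    rw [this]
    exact Measurable.piecewise hGm measurable_const (hf U hU)
  refine ⟨⟨κ₀, hκ₀⟩, ⟨hprob⟩, ?_⟩
  have : ∀ᵐ x ∂m, x ∉ G := measure_eq_zero_iff_ae_notMem.1 hG0
  filter_upwards [this] with x hx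
  change κ₀ x = μ x
  simp [κ₀, hx]

end YoungKernel

/-! ### Test functions on Tⁿ × ℝ and convergence of joint laws. -/

section TestFunctions

lemma youngHat_eq_compProd {X S : Type*} [MeasurableSpace X] [TopologicalSpace S]
    [MeasurableSpace S] {m : Measure X} [SFinite m] {μ : X → Measure S} {κ : Kernel X S} [IsMarkovKernel κ]
    (hκ : ∀ᵐ x ∂m, κ x = μ x) {A : Set (X × S)} (hA : MeasurableSet A) :
    youngHat m μ A = (m ⊗ₘ κ) A := by
  rw [Measure.compProd_apply hA, youngHat]
  refine lintegral_congr_ae ?_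
  filter_upwards [hκ] with x hx
  rw [hx]; rfl


/-- The tensor product with a compactly supported function on `ℝ`, as an operator from continuous
functions on a compact space `K` to continuous functions on `K × ℝ` which vanish at infinity. -/
noncomputable def tensorZeroAtInfty (K : Type*) [TopologicalSpace K] [CompactSpace K]
    [T2Space K] {g : ℝ → ℝ}
    (hg : Continuous g) (hgs : HasCompactSupport g) : C(K, ℝ) →L[ℝ] C₀(K × ℝ, ℝ) :=
  LinearMap.mkContinuousOfExistsBound
    { toFun := fun f =>
        { toFun := fun p => f p.1 * g p.2
          continuous_toFun := by fun_prop
          zero_at_infty' := by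
            apply HasCompactSupport.is_zero_at_infty
            refine HasCompactSupport.intro (isCompact_univ.prod hgs) fun p hp => ?_
            have hp2 : p.2 ∉ tsupport g := fun h => hp ⟨mem_univ _, h⟩
            rw [image_eq_zero_of_notMem_tsupport hp2, mul_zero] }
      map_add' := fun f f' => by ext p; simp [add_mul]
      map_smul' := fun a f => by ext p; simp [mul_assoc] }
    (by
      obtain ⟨C, hC⟩ := hgs.exists_bound_of_continuous hg
      refine ⟨C, fun f => ?_⟩
      have hC0 : 0 ≤ C := (norm_nonneg _).trans (hC 0)
      rw [← ZeroAtInftyContinuousMap.norm_toBCF_eq_norm,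
        BoundedContinuousFunction.norm_le (by positivity)]
      intro p
      calc ‖f p.1 * g p.2‖ = ‖f p.1‖ * ‖g p.2‖ := norm_mul _ _
        _ ≤ ‖f‖ * C := mul_le_mul (f.norm_coe_le_norm _) (hC _) (norm_nonneg _) (norm_nonneg _)
        _ = C * ‖f‖ := mul_comm _ _)

lemma continuous_toTorus {n d : ℕ} : Continuous (toTorus : (Fin n → Fin d → ℝ) → TorusPow n d) :=
  continuous_pi fun k => continuous_pi fun i =>
    (AddCircle.continuous_mk' 1).comp ((continuous_apply i).comp (continuous_apply k))

lemma measurable_toTorus {n d : ℕ} :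
    Measurable (toTorus : (Fin n → Fin d → ℝ) → TorusPow n d) :=
  continuous_toTorus.measurable

lemma measurable_oscVar {n d : ℕ} (ρ : Fin n → ℝ → ℝ) (ε : ℕ → ℝ) (h : ℕ) :
    Measurable (oscVar (d := d) ρ ε h) :=
  measurable_pi_lambda _ fun _ => measurable_pi_lambda _ fun i =>
    measurable_fract.comp ((measurable_pi_apply i).div_const _)

/-- As Tⁿ is compact and g has compact support, c ⊗ g is a legitimate element of L¹(Ω, C₀(Tⁿ × ℝ)).
The identity μ̂ = ν̂ moves its limit integral from the variables (x, (t, z)) to ((x, y), z). -/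
lemma GeneratesMultiscaleYoungMeasure.tendsto_integral {n d : ℕ} {Ω : Set (Fin d → ℝ)}
    {ρ : Fin n → ℝ → ℝ} {ε : ℕ → ℝ} {u : ℕ → (Fin d → ℝ) → ℝ}
    {ν : (Fin d → ℝ) × (Fin n → Fin d → ℝ) → Measure ℝ}
    (hν : GeneratesMultiscaleYoungMeasure Ω ρ ε u ν)
    {κ : Kernel ((Fin d → ℝ) × (Fin n → Fin d → ℝ)) ℝ} [IsMarkovKernel κ]
    (hκ : ∀ᵐ p ∂(macroMicro n Ω), κ p = ν p)
    {c : (Fin d → ℝ) → C(TorusPow n d, ℝ)} (hcm : StronglyMeasurable c)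
    (hc : IntegrableOn c Ω) {g : ℝ → ℝ} (hg : Continuous g) (hgs : HasCompactSupport g) :
    Tendsto (fun h => ∫ x in Ω, c x (toTorus (oscVar ρ ε h x)) * g (u h x)) atTop
      (𝓝 (∫ p, c p.1.1 (toTorus p.1.2) * g p.2 ∂(macroMicro n Ω ⊗ₘ κ))) := by
  obtain ⟨-, μ, hμ, hhat⟩ := hν
  have hSF : SFinite (macroMicro n Ω) := by unfold macroMicro; infer_instance
  obtain ⟨η, hη, hημ⟩ := hμ.isYoungFamily.exists_kernel
  let τ : ((Fin d → ℝ) × (Fin n → Fin d → ℝ)) × ℝ → (Fin d → ℝ) × (TorusPow n d × ℝ) :=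
    fun p => (p.1.1, (toTorus p.1.2, p.2))
  have hτ : Measurable τ := by
    have := measurable_toTorus (n := n) (d := d)
    fun_prop
  -- The set functions μ̂ and ν̂ are composition products with kernels, so their coincidence is an
  -- equality of measures after identifying □ⁿ with Tⁿ.
  have hmap : volume.restrict Ω ⊗ₘ η = (macroMicro n Ω ⊗ₘ κ).map τ := by
    ext A hA
    rw [← youngHat_eq_compProd hημ hA, hhat A hA, Measure.map_apply hτ hA]
    exact youngHat_eq_compProd hκ (hτ hA)
  let T := tensorZeroAtInfty (TorusPow n d) hg hgs
  have hsm : StronglyMeasurable fun q : (Fin d → ℝ) × (TorusPow n d × ℝ) => T (c q.1) q.2 := by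
    have h1 : StronglyMeasurable fun q : (Fin d → ℝ) × (TorusPow n d × ℝ) => (c q.1, q.2.1) :=
      (hcm.comp_measurable measurable_fst).prodMk
        (measurable_fst.comp measurable_snd).stronglyMeasurable
    have h2 : Continuous fun r : C(TorusPow n d, ℝ) × TorusPow n d => r.1 r.2 := by fun_prop
    exact (h2.comp_stronglyMeasurable h1).mul
      (hg.measurable.comp (measurable_snd.comp measurable_snd)).stronglyMeasurable
  have hTc : IntegrableOn (fun x => T (c x)) Ω := T.integrable_comp hc
  have hint : Integrable (fun q : (Fin d → ℝ) × (TorusPow n d × ℝ) => T (c q.1) q.2)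
      (volume.restrict Ω ⊗ₘ η) := by
    have h1 : Integrable (fun q : (Fin d → ℝ) × (TorusPow n d × ℝ) => ‖T (c q.1)‖)
        (volume.restrict Ω ⊗ₘ η) := by
      have h2 : Integrable (fun x => ‖T (c x)‖) (volume.restrict Ω ⊗ₘ η).fst := by
        rw [Measure.fst_compProd]; exact hTc.norm
      exact h2.comp_measurable measurable_fst
    refine h1.mono' hsm.aestronglyMeasurable (Eventually.of_forall fun q => ?_)
    rw [← ZeroAtInftyContinuousMap.norm_toBCF_eq_norm]
    exact (T (c q.1)).toBCF.norm_coe_le_norm q.2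
  have hlim := hμ.tendsto (fun x => T (c x)) hTc
  have heq : ∫ x in Ω, (∫ s, T (c x) s ∂(μ x))
      = ∫ p, c p.1.1 (toTorus p.1.2) * g p.2 ∂(macroMicro n Ω ⊗ₘ κ) := by
    calc ∫ x in Ω, (∫ s, T (c x) s ∂(μ x))
        = ∫ x in Ω, (∫ s, T (c x) s ∂(η x)) := by
          refine integral_congr_ae ?_
          filter_upwards [hημ] with x hx
          rw [hx]
      _ = ∫ q, T (c q.1) q.2 ∂(volume.restrict Ω ⊗ₘ η) :=
          (Measure.integral_compProd hint).symm
      _ = _ := by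
          rw [hmap, integral_map hτ.aemeasurable hsm.aestronglyMeasurable]
          rfl
  rw [← heq]
  exact hlim

end TestFunctions

/-! ### Unit cells and fractional parts. -/

section Cells

lemma measurableSet_unitCell (d : ℕ) : MeasurableSet (unitCell d) :=
  MeasurableSet.univ_pi fun _ => measurableSet_Ico

lemma volume_unitCell (d : ℕ) : volume (unitCell d) = 1 := by
  simp [unitCell, volume_pi_pi]

lemma volume_unitCellPow (n d : ℕ) : volume (unitCellPow n d) = 1 := by
  simp [unitCellPow, volume_pi_pi, volume_unitCell]

lemma fract_mem_unitCell {d : ℕ} (y : Fin d → ℝ) : (fun i => Int.fract (y i)) ∈ unitCell d :=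
  fun _ _ => ⟨Int.fract_nonneg _, Int.fract_lt_one _⟩

lemma injOn_toTorus {n d : ℕ} :
    InjOn (toTorus : (Fin n → Fin d → ℝ) → TorusPow n d) (unitCellPow n d) := by
  intro y hy z hz hyz
  funext k i
  have h1 : ((y k i : ℝ) : UnitAddCircle) = (z k i : ℝ) := congrFun (congrFun hyz k) i
  have hy' : y k i ∈ Ico (0 : ℝ) (0 + 1) := by simpa using hy k (mem_univ _) i (mem_univ _)
  have hz' : z k i ∈ Ico (0 : ℝ) (0 + 1) := by simpa using hz k (mem_univ _) i (mem_univ _)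
  exact (AddCircle.coe_eq_coe_iff_of_mem_Ico hy' hz').1 h1

open Pointwise in
/-- The fractional part of `x / r` spreads the mass of a bounded set over the unit cell with a
bounded density, uniformly in `r ≤ M`. -/
lemma volume_inter_fract_le {d : ℕ} {Ω : Set (Fin d → ℝ)} {R M r : ℝ}
    (hΩ : ∀ x ∈ Ω, ∀ i, |x i| ≤ R) (hR : 0 ≤ R) (hr : 0 < r) (hrM : r ≤ M)
    (B : Set (Fin d → ℝ)) :
    volume (Ω ∩ {x | (fun i => Int.fract (x i / r)) ∈ B})
      ≤ ENNReal.ofReal ((2 * R + 3 * M) ^ d) * volume (unitCell d ∩ B) := by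
  set K : ℤ := ⌊R / r⌋ + 1 with hK
  have hfl : 0 ≤ ⌊R / r⌋ := Int.floor_nonneg.2 (by positivity)
  let I : Finset (Fin d → ℤ) := Fintype.piFinset fun _ => Finset.Icc (-K) K
  -- The points with ⌊x/r⌋ = m and fractional part in B lie in r(m + □ ∩ B), of measure rᵈ|□ ∩ B|.
  -- The indices that meet Ω are in [-K, K]ᵈ.
  let A : (Fin d → ℤ) → Set (Fin d → ℝ) := fun m =>
    r • ((fun y => (fun i => (m i : ℝ)) + y) '' (unitCell d ∩ B))
  have hsub : Ω ∩ {x | (fun i => Int.fract (x i / r)) ∈ B} ⊆ ⋃ m ∈ I, A m := by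
    rintro x ⟨hx, hxB⟩
    refine mem_iUnion₂.2 ⟨fun i => ⌊x i / r⌋, ?_, ?_⟩
    · refine Fintype.mem_piFinset.2 fun i => Finset.mem_Icc.2 ⟨?_, ?_⟩
      · rw [Int.le_floor]
        have h1 : -(R / r) ≤ x i / r := by
          rw [← neg_div]
          exact div_le_div_of_nonneg_right (neg_le_of_abs_le (hΩ x hx i)) hr.le
        have h2 := (Int.lt_floor_add_one (R / r)).le
        push_cast [hK]
        linarith
      · have h1 : x i / r ≤ R / r :=
          div_le_div_of_nonneg_right (le_of_abs_le (hΩ x hx i)) hr.le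
        have := Int.floor_le_floor h1
        omega
    · refine ⟨_, ⟨fun i => Int.fract (x i / r), ⟨fract_mem_unitCell _, hxB⟩, rfl⟩, ?_⟩
      funext i
      simp only [Pi.smul_apply, Pi.add_apply, smul_eq_mul, Int.floor_add_fract]
      field_simp
  have hA : ∀ m, volume (A m) = ENNReal.ofReal (r ^ d) * volume (unitCell d ∩ B) := by
    intro m
    simp only [A]
    rw [Measure.addHaar_smul, Module.finrank_fin_fun, abs_of_pos (by positivity), image_add_left,
      measure_preimage_add]
  have hcard : I.card = (2 * K + 1).toNat ^ d := by
    simp only [I, Fintype.card_piFinset, Int.card_Icc, Finset.prod_const, Finset.card_univ,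
      Fintype.card_fin]
    congr 2; ring
  -- Since K r ≤ R + r, one has (2K + 1) r ≤ 2R + 3r, whence the constant 2R + 3M.
  have hKr : ((2 * K + 1).toNat : ℝ) * r ≤ 2 * R + 3 * M := by
    have h1 : ((2 * K + 1).toNat : ℝ) = 2 * K + 1 := by
      have : ((2 * K + 1).toNat : ℤ) = 2 * K + 1 := Int.toNat_of_nonneg (by omega)
      exact_mod_cast this
    have h2 : (⌊R / r⌋ : ℝ) * r ≤ R := by
      rw [← le_div_iff₀ hr]; exact Int.floor_le _
    rw [h1, hK]
    push_cast
    nlinarith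
  calc volume (Ω ∩ {x | (fun i => Int.fract (x i / r)) ∈ B})
      ≤ ∑ m ∈ I, volume (A m) := (measure_mono hsub).trans (measure_biUnion_finset_le _ _)
    _ = ENNReal.ofReal (((2 * K + 1).toNat * r) ^ d) * volume (unitCell d ∩ B) := by
        simp only [hA, Finset.sum_const, hcard, nsmul_eq_mul]
        rw [← mul_assoc, mul_pow, ENNReal.ofReal_mul (by positivity)]
        congr 2
        rw [← Nat.cast_pow, ENNReal.ofReal_natCast]
    _ ≤ _ := by
        gcongr

end Cells

/-! ### Measures with spread marginals and admissible functions. -/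

section SpreadMarginals

/-- Triples `((x, y), z)` of a macroscopic variable, microscopic variables, and a value. -/
abbrev MicroTriple (n d : ℕ) : Type := ((Fin d → ℝ) × (Fin n → Fin d → ℝ)) × ℝ

/-- The marginals of `Q` in the macroscopic variable and in each of the microscopic variables
have densities bounded by `C` with respect to Lebesgue measure on `Ω`, resp. on `□`. -/
structure HasSpreadMarginals {n d : ℕ} (C : ℝ≥0∞) (Ω : Set (Fin d → ℝ))
    (Q : Measure (MicroTriple n d)) : Prop where
  macro_le : ∀ B, MeasurableSet B → Q {p | p.1.1 ∈ B} ≤ C * volume (Ω ∩ B)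
  micro_le : ∀ k B, MeasurableSet B → Q {p | p.1.2 k ∈ B} ≤ C * volume (unitCell d ∩ B)

variable {n d : ℕ} {C : ℝ≥0∞} {Ω : Set (Fin d → ℝ)} {Q : Measure (MicroTriple n d)}

/-- The triples whose macroscopic variable lies in `X` and whose microscopic variables all lie
in `Y`. -/
def goodTriples (n : ℕ) {d : ℕ} (X Y : Set (Fin d → ℝ)) : Set (MicroTriple n d) :=
  Prod.fst ⁻¹' (X ×ˢ Set.pi univ fun _ : Fin n => Y)

lemma measurableSet_goodTriples {X Y : Set (Fin d → ℝ)} (hX : MeasurableSet X)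
    (hY : MeasurableSet Y) : MeasurableSet (goodTriples n X Y) :=
  measurable_fst (hX.prod (MeasurableSet.univ_pi fun _ => hY))

namespace HasSpreadMarginals

lemma isFiniteMeasure (hQ : HasSpreadMarginals C Ω Q) (hC : C ≠ ∞) (hΩ : volume Ω ≠ ∞) :
    IsFiniteMeasure Q := by
  refine ⟨?_⟩
  have := hQ.macro_le univ MeasurableSet.univ
  simp only [mem_univ, ofPred_true, inter_univ] at this
  exact this.trans_lt (ENNReal.mul_lt_top hC.lt_top hΩ.lt_top)

lemma ae_of_ae_fst (hQ : HasSpreadMarginals C Ω Q) {P : (Fin d → ℝ) → Prop}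
    (hP : ∀ᵐ x ∂(volume.restrict Ω), P x) : ∀ᵐ p ∂Q, P p.1.1 := by
  obtain ⟨G, hGsub, hGm, hG0⟩ := exists_measurable_superset_of_null (ae_iff.1 hP)
  rw [Measure.restrict_apply hGm, inter_comm] at hG0
  have h := hQ.macro_le G hGm
  rw [hG0, mul_zero, nonpos_iff_eq_zero] at h
  exact measure_mono_null (fun p hp => hGsub hp) h

/-- A union bound: for a bad triple x leaves X or one of the n variables y_k leaves Y, and each of
these n + 1 events involves a single marginal. No joint density in (x, y) is needed, and the laws
along v_h have none. -/
lemma measure_compl_goodTriples_le (hQ : HasSpreadMarginals C Ω Q) {X Y : Set (Fin d → ℝ)}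
    (hX : MeasurableSet X) (hY : MeasurableSet Y) {δ : ℝ≥0∞} (hXδ : volume (Ω \ X) ≤ δ)
    (hYδ : volume (unitCell d \ Y) ≤ δ) : Q (goodTriples n X Y)ᶜ ≤ C * (n + 1) * δ := by
  have hsub : (goodTriples n X Y)ᶜ ⊆ {p : MicroTriple n d | p.1.1 ∈ Xᶜ} ∪
      ⋃ k : Fin n, {p : MicroTriple n d | p.1.2 k ∈ Yᶜ} := by
    intro p hp
    by_contra hcon
    simp only [mem_union, mem_ofPred_eq, mem_iUnion, mem_compl_iff, not_or, not_not,
      not_exists] at hcon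
    exact hp ⟨hcon.1, fun k _ => hcon.2 k⟩
  calc Q (goodTriples n X Y)ᶜ
      ≤ Q {p | p.1.1 ∈ Xᶜ} + ∑ k : Fin n, Q {p | p.1.2 k ∈ Yᶜ} :=
        (measure_mono hsub).trans ((measure_union_le _ _).trans
          (add_le_add le_rfl (measure_iUnion_fintype_le _ _)))
    _ ≤ C * δ + ∑ _k : Fin n, C * δ := by
        gcongr with k
        · exact (hQ.macro_le _ hX.compl).trans (by gcongr; exact hXδ)
        · exact (hQ.micro_le k _ hY.compl).trans (by gcongr; exact hYδ)
    _ = C * (n + 1) * δ := by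
        simp only [Finset.sum_const, Finset.card_univ, Fintype.card_fin, nsmul_eq_mul]
        ring

lemma ae_mem (hQ : HasSpreadMarginals C Ω Q) (hΩ : MeasurableSet Ω) :
    ∀ᵐ p ∂Q, p.1.1 ∈ Ω ∧ p.1.2 ∈ unitCellPow n d := by
  have h := hQ.measure_compl_goodTriples_le hΩ (measurableSet_unitCell d) (δ := 0) (by simp)
    (by simp)
  rw [mul_zero, nonpos_iff_eq_zero] at h
  filter_upwards [measure_eq_zero_iff_ae_notMem.1 h] with p hp
  simpa [goodTriples, unitCellPow] using hp

/-- Measurability of ψ is not part of admissibility. It holds because ψ is continuous on each good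
set, and the good sets for δ = 1/(j + 1) cover `Q`-almost everything. -/
lemma aestronglyMeasurable (hQ : HasSpreadMarginals C Ω Q) (hC : C ≠ ∞)
    {ψ : (Fin d → ℝ) → (Fin n → Fin d → ℝ) → ℝ} (hψ : IsAdmissible Ω ψ) :
    AEStronglyMeasurable (fun p : MicroTriple n d => ψ p.1.1 p.1.2) Q := by
  have hpos : ∀ j : ℕ, (0 : ℝ) < 1 / ((j : ℝ) + 1) := fun j => by positivity
  choose X Y hX hXΩ hXδ hY hYc hYδ hc using fun j : ℕ => hψ _ (hpos j)
  have hG : ∀ j, MeasurableSet (goodTriples n (X j) (Y j)) := fun j =>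
    measurableSet_goodTriples (hX j).measurableSet (hY j).measurableSet
  have hnull : Q (⋃ j, goodTriples n (X j) (Y j))ᶜ = 0 := by
    have hle : ∀ j : ℕ, Q (⋃ j, goodTriples n (X j) (Y j))ᶜ
        ≤ C * (n + 1) * ENNReal.ofReal (1 / ((j : ℝ) + 1)) := fun j =>
      (measure_mono (compl_subset_compl.2 (subset_iUnion _ j))).trans
        (hQ.measure_compl_goodTriples_le (hX j).measurableSet (hY j).measurableSet (hXδ j) (hYδ j))
    have hlim : Tendsto (fun j : ℕ => C * (n + 1) * ENNReal.ofReal (1 / ((j : ℝ) + 1))) atTop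
        (𝓝 0) := by
      have h1 := ENNReal.tendsto_ofReal (tendsto_one_div_add_atTop_nhds_zero_nat (𝕜 := ℝ))
      rw [ENNReal.ofReal_zero] at h1
      have h2 := ENNReal.Tendsto.const_mul (a := C * (n + 1)) h1
        (Or.inr (ENNReal.mul_ne_top hC (by finiteness)))
      rwa [mul_zero] at h2
    exact nonpos_iff_eq_zero.1 (ge_of_tendsto' hlim hle)
  have hrestr : Q.restrict (⋃ j, goodTriples n (X j) (Y j)) = Q :=
    Measure.restrict_eq_self_of_ae_mem (by
      filter_upwards [measure_eq_zero_iff_ae_notMem.1 hnull] with p hp using not_not.1 hp)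
  rw [← hrestr, aestronglyMeasurable_iUnion_iff]
  intro j
  have hcont : ContinuousOn (fun p : MicroTriple n d => ψ p.1.1 p.1.2)
      (goodTriples n (X j) (Y j)) :=
    (hc j).comp continuous_fst.continuousOn fun p hp => hp
  exact hcont.aestronglyMeasurable (hG j)

end HasSpreadMarginals

lemma abs_integral_sub_integral_le {α : Type*} [MeasurableSpace α] {Q : Measure α}
    [IsFiniteMeasure Q] {f g : α → ℝ} (hf : Integrable f Q) (hg : Integrable g Q) {G : Set α}
    (hG : MeasurableSet G) (hfg : ∀ᵐ p ∂Q, p ∈ G → f p = g p) {K : ℝ}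
    (hK : ∀ᵐ p ∂Q, |f p - g p| ≤ K) : |∫ p, f p ∂Q - ∫ p, g p ∂Q| ≤ K * Q.real Gᶜ := by
  rw [← integral_sub hf hg]
  calc |∫ p, (f p - g p) ∂Q| ≤ ∫ p, |f p - g p| ∂Q := abs_integral_le_integral_abs
    _ ≤ ∫ p, Gᶜ.indicator (fun _ => K) p ∂Q := by
        refine integral_mono_ae (hf.sub hg).abs
          ((integrable_const K).indicator hG.compl) ?_
        filter_upwards [hfg, hK] with p h1 h2
        by_cases hp : p ∈ G
        · simp [hp, h1 hp]
        · simpa [hp] using h2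
    _ = K * Q.real Gᶜ := by
        rw [integral_indicator hG.compl]
        simp [mul_comm]

/-- Tietze extension of an admissible function from a product of compact sets, as a function on
the torus. -/
lemma exists_continuousMap_torus_eq {X Y : Set (Fin d → ℝ)} (hX : IsCompact X) (hY : IsCompact Y)
    (hYc : Y ⊆ unitCell d) {ψ : (Fin d → ℝ) → (Fin n → Fin d → ℝ) → ℝ}
    (hψ : ContinuousOn (fun p : (Fin d → ℝ) × (Fin n → Fin d → ℝ) => ψ p.1 p.2)
      (X ×ˢ Set.pi univ fun _ : Fin n => Y)) {L : ℝ} (hL : 0 ≤ L)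
    (hψL : ∀ x ∈ X, ∀ y ∈ Set.pi univ fun _ : Fin n => Y, |ψ x y| ≤ L) :
    ∃ F : C((Fin d → ℝ) × TorusPow n d, ℝ), (∀ q, |F q| ≤ L) ∧
      ∀ x ∈ X, ∀ y ∈ Set.pi univ fun _ : Fin n => Y, F (x, toTorus y) = ψ x y := by
  set Z : Set ((Fin d → ℝ) × (Fin n → Fin d → ℝ)) := X ×ˢ Set.pi univ fun _ : Fin n => Y with hZ
  have hZc : IsCompact Z := hX.prod (isCompact_univ_pi fun _ => hY)
  have : CompactSpace Z := isCompact_iff_compactSpace.1 hZc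
  let e : Z → (Fin d → ℝ) × TorusPow n d := fun p => (p.1.1, toTorus p.1.2)
  have he : Continuous e := by
    have := continuous_toTorus (n := n) (d := d)
    fun_prop
  have hinj : Function.Injective e := by
    rintro ⟨⟨x, y⟩, hx, hy⟩ ⟨⟨x', y'⟩, hx', hy'⟩ h
    have h1 : x = x' := congrArg Prod.fst h
    have h2 : toTorus y = toTorus y' := congrArg Prod.snd h
    have h3 : y = y' := injOn_toTorus (fun k hk => hYc (hy k hk)) (fun k hk => hYc (hy' k hk)) h2
    subst h1 h3; rfl
  -- A continuous injection of a compact space into a Hausdorff space; injectivity holds because Y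
  -- lies in the half-open cell.
  have hcl : IsClosedEmbedding e := he.isClosedEmbedding hinj
  let f : BoundedContinuousFunction Z ℝ := BoundedContinuousFunction.mkOfCompact
    ⟨fun p => ψ p.1.1 p.1.2, continuousOn_iff_continuous_domRestrict.1 hψ⟩
  have hf : ‖f‖ ≤ L := (BoundedContinuousFunction.norm_le hL).2 fun p =>
    hψL _ p.2.1 _ p.2.2
  obtain ⟨F, hFn, hFe⟩ := f.exists_extension_norm_eq_of_isClosedEmbedding hcl
  refine ⟨F.toContinuousMap, fun q => (F.norm_coe_le_norm q).trans (hFn.trans_le hf), ?_⟩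
  intro x hx y hy
  exact congrFun hFe ⟨(x, y), hx, hy⟩

end SpreadMarginals

/-! ### Passage to the limit: bounded, then dominated integrands. -/

section Limits

variable {n d : ℕ} {C : ℝ≥0∞} {Ω : Set (Fin d → ℝ)} {Qs : ℕ → Measure (MicroTriple n d)}
  {Q : Measure (MicroTriple n d)}

/-- Convergence of integrals of `c(x, y) g(z)`, with `c` an integrable map from `Ω` to the
continuous functions on `Tⁿ` and `g` continuous with compact support. -/
def TestConvergence (Ω : Set (Fin d → ℝ)) (Qs : ℕ → Measure (MicroTriple n d))
    (Q : Measure (MicroTriple n d)) : Prop :=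
  ∀ c : (Fin d → ℝ) → C(TorusPow n d, ℝ), StronglyMeasurable c → IntegrableOn c Ω →
    ∀ g : ℝ → ℝ, Continuous g → HasCompactSupport g →
      Tendsto (fun h => ∫ p, c p.1.1 (toTorus p.1.2) * g p.2 ∂(Qs h)) atTop
        (𝓝 (∫ p, c p.1.1 (toTorus p.1.2) * g p.2 ∂Q))

lemma stronglyMeasurable_eval_toTorus {c : (Fin d → ℝ) → C(TorusPow n d, ℝ)}
    (hc : StronglyMeasurable c) :
    StronglyMeasurable fun p : MicroTriple n d => c p.1.1 (toTorus p.1.2) := by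
  have h1 : StronglyMeasurable fun p : MicroTriple n d => (c p.1.1, toTorus p.1.2) :=
    (hc.comp_measurable (measurable_fst.comp measurable_fst)).prodMk
      (measurable_toTorus.comp (measurable_snd.comp measurable_fst)).stronglyMeasurable
  have h2 : Continuous fun r : C(TorusPow n d, ℝ) × TorusPow n d => r.1 r.2 := by fun_prop
  exact h2.comp_stronglyMeasurable h1

/-- A bounded admissible function is approximated by continuous functions on the torus, uniformly
over all measures with spread marginals. -/
lemma exists_approx_of_bounded (hΩ : MeasurableSet Ω) (hΩf : volume Ω ≠ ∞) (hC : C ≠ ∞)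
    {ψ : (Fin d → ℝ) → (Fin n → Fin d → ℝ) → ℝ} (hψ : IsAdmissible Ω ψ) {L : ℝ} (hL : 0 ≤ L)
    (hψL : ∀ x ∈ Ω, ∀ y ∈ unitCellPow n d, |ψ x y| ≤ L) {g : ℝ → ℝ} (hg : Continuous g)
    (hgs : HasCompactSupport g) {e : ℝ} (he : 0 < e) :
    ∃ c : (Fin d → ℝ) → C(TorusPow n d, ℝ), StronglyMeasurable c ∧ IntegrableOn c Ω ∧
      ∀ Q' : Measure (MicroTriple n d), HasSpreadMarginals C Ω Q' →
        |∫ p, ψ p.1.1 p.1.2 * g p.2 ∂Q' - ∫ p, c p.1.1 (toTorus p.1.2) * g p.2 ∂Q'| ≤ e := by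
  obtain ⟨M, hM⟩ := hgs.exists_bound_of_continuous hg
  have hM0 : 0 ≤ M := (norm_nonneg _).trans (hM 0)
  -- The two integrands differ by at most 2LM, and only on a set of mass at most C(n + 1)δ, so the
  -- error is D δ. The 1 added in δ = e/(D + 1) covers D = 0.
  set D : ℝ := 2 * L * M * (C.toReal * (n + 1)) with hD
  have hD0 : 0 ≤ D := by positivity
  set δ : ℝ := e / (D + 1) with hδ
  have hδ0 : 0 < δ := by positivity
  obtain ⟨X, Y, hX, hXΩ, hXδ, hY, hYc, hYδ, hc⟩ := hψ δ hδ0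
  have hYpow : ∀ y ∈ Set.pi univ fun _ : Fin n => Y, y ∈ unitCellPow n d :=
    fun y hy k hk => hYc (hy k hk)
  obtain ⟨F, hFL, hFψ⟩ := exists_continuousMap_torus_eq hX hY hYc hc hL
    fun x hx y hy => hψL x (hXΩ hx) y (hYpow y hy)
  let c : (Fin d → ℝ) → C(TorusPow n d, ℝ) := X.indicator fun x => F.curry x
  have hcsm : StronglyMeasurable c :=
    F.curry.continuous.stronglyMeasurable.indicator hX.measurableSet
  have hcval : ∀ x t, |c x t| ≤ L := by
    intro x t
    by_cases hx : x ∈ X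
    · simpa [c, hx] using hFL (x, t)
    · simpa [c, hx] using hL
  have hcint : IntegrableOn c Ω := by
    have : IsFiniteMeasure (volume.restrict Ω) := ⟨by simpa using hΩf.lt_top⟩
    exact Integrable.of_bound hcsm.aestronglyMeasurable L
      (Eventually.of_forall fun x => (ContinuousMap.norm_le _ hL).2 (hcval x))
  refine ⟨c, hcsm, hcint, fun Q' hQ' => ?_⟩
  have hfin := hQ'.isFiniteMeasure hC hΩf
  have hgm : AEStronglyMeasurable (fun p : MicroTriple n d => g p.2) Q' :=
    (hg.comp continuous_snd).aestronglyMeasurable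
  have hG := measurableSet_goodTriples (n := n) hX.measurableSet hY.measurableSet
  have hmem := hQ'.ae_mem hΩ
  have hψb : ∀ᵐ p ∂Q', |ψ p.1.1 p.1.2| ≤ L := by
    filter_upwards [hmem] with p hp using hψL _ hp.1 _ hp.2
  have h1 : Integrable (fun p : MicroTriple n d => ψ p.1.1 p.1.2 * g p.2) Q' := by
    refine Integrable.of_bound ((hQ'.aestronglyMeasurable hC hψ).mul hgm) (L * M) ?_
    filter_upwards [hψb] with p hp
    rw [norm_mul]
    exact mul_le_mul hp (hM _) (norm_nonneg _) hL
  have h2 : Integrable (fun p : MicroTriple n d => c p.1.1 (toTorus p.1.2) * g p.2) Q' := by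
    refine Integrable.of_bound
      ((stronglyMeasurable_eval_toTorus hcsm).aestronglyMeasurable.mul hgm) (L * M)
      (Eventually.of_forall fun p => ?_)
    rw [norm_mul]
    exact mul_le_mul (hcval _ _) (hM _) (norm_nonneg _) hL
  have hle := abs_integral_sub_integral_le h1 h2 hG (K := 2 * L * M)
    (Eventually.of_forall fun p hp => by
      have hp1 : p.1.1 ∈ X := hp.1
      simp only [c, hp1, indicator_of_mem, ContinuousMap.curry_apply]
      rw [hFψ _ hp.1 _ hp.2])
    (by
      filter_upwards [hψb] with p hp
      rw [← sub_mul, abs_mul]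
      refine mul_le_mul ?_ (hM _) (abs_nonneg _) (by positivity)
      calc |ψ p.1.1 p.1.2 - c p.1.1 (toTorus p.1.2)|
          ≤ |ψ p.1.1 p.1.2| + |c p.1.1 (toTorus p.1.2)| := abs_sub _ _
        _ ≤ 2 * L := by linarith [hcval p.1.1 (toTorus p.1.2)])
  have hbad : Q'.real (goodTriples n X Y)ᶜ ≤ C.toReal * (n + 1) * δ := by
    have h := hQ'.measure_compl_goodTriples_le hX.measurableSet hY.measurableSet hXδ hYδ
    have h' := ENNReal.toReal_mono (by finiteness) h
    rw [ENNReal.toReal_mul, ENNReal.toReal_mul, ENNReal.toReal_ofReal hδ0.le] at h'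
    have h3 : ((n : ℝ≥0∞) + 1).toReal = n + 1 := by
      rw [ENNReal.toReal_add (by simp) (by simp)]; simp
    rwa [h3] at h'
  calc _ ≤ 2 * L * M * Q'.real (goodTriples n X Y)ᶜ := hle
    _ ≤ 2 * L * M * (C.toReal * (n + 1) * δ) := by gcongr
    _ = D * δ := by rw [hD]; ring
    _ ≤ e := by
        rw [hδ, mul_div_assoc', div_le_iff₀ (by positivity)]
        nlinarith

/-- The approximating c is chosen before the measure, so the same c serves `Q` and every `Qs h`, and
a three-term estimate concludes. -/
lemma TestConvergence.tendsto_integral_of_bounded (hconv : TestConvergence Ω Qs Q)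
    (hΩ : MeasurableSet Ω) (hΩf : volume Ω ≠ ∞) (hC : C ≠ ∞)
    (hQs : ∀ h, HasSpreadMarginals C Ω (Qs h)) (hQ : HasSpreadMarginals C Ω Q)
    {ψ : (Fin d → ℝ) → (Fin n → Fin d → ℝ) → ℝ} (hψ : IsAdmissible Ω ψ) {L : ℝ} (hL : 0 ≤ L)
    (hψL : ∀ x ∈ Ω, ∀ y ∈ unitCellPow n d, |ψ x y| ≤ L) {g : ℝ → ℝ} (hg : Continuous g)
    (hgs : HasCompactSupport g) :
    Tendsto (fun h => ∫ p, ψ p.1.1 p.1.2 * g p.2 ∂(Qs h)) atTop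
      (𝓝 (∫ p, ψ p.1.1 p.1.2 * g p.2 ∂Q)) := by
  rw [Metric.tendsto_nhds]
  intro e he
  obtain ⟨c, hcsm, hcint, hc⟩ := exists_approx_of_bounded hΩ hΩf hC hψ hL hψL hg hgs
    (show 0 < e / 3 by positivity)
  filter_upwards [Metric.tendsto_nhds.1 (hconv c hcsm hcint g hg hgs) (e / 3) (by positivity)]
    with h hh
  rw [Real.dist_eq] at hh ⊢
  have h1 := abs_le.1 (hc _ (hQs h))
  have h2 := abs_le.1 (hc _ hQ)
  have h3 := abs_lt.1 hh
  rw [abs_lt]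
  constructor <;> linarith

/-- Lower semicontinuity: truncating α and |z| gives test functions `f j`, whose integrals inherit
the bound B in the limit h → ∞. Fatou's lemma in j then removes the truncation. -/
lemma TestConvergence.integrable_mul_abs (hconv : TestConvergence Ω Qs Q) (hΩf : volume Ω ≠ ∞)
    (hC : C ≠ ∞) (hQs : ∀ h, HasSpreadMarginals C Ω (Qs h)) (hQ : HasSpreadMarginals C Ω Q)
    {α : (Fin d → ℝ) → ℝ} (hαm : Measurable α) (hα : ∀ᵐ x ∂(volume.restrict Ω), 0 < α x)
    {B : ℝ≥0∞} (hB : B ≠ ∞)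
    (hbound : ∀ h, ∫⁻ p, ENNReal.ofReal (α p.1.1 * |p.2|) ∂(Qs h) ≤ B) :
    Integrable (fun p : MicroTriple n d => α p.1.1 * |p.2|) Q := by
  have hm : Measurable fun p : MicroTriple n d => α p.1.1 * |p.2| := by fun_prop
  have hα0 : ∀ Q' : Measure (MicroTriple n d), HasSpreadMarginals C Ω Q' →
      ∀ᵐ p ∂Q', 0 < α p.1.1 := fun Q' hQ' => hQ'.ae_of_ae_fst hα
  let c : ℕ → (Fin d → ℝ) → C(TorusPow n d, ℝ) := fun j x =>
    ContinuousMap.const _ (max 0 (min (α x) j))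
  let g : ℕ → ℝ → ℝ := fun j z => |z| * plateau j z
  have hcsm : ∀ j, StronglyMeasurable (c j) := fun j =>
    ContinuousMap.continuous_const'.comp_stronglyMeasurable
      (by fun_prop : Measurable fun x => max 0 (min (α x) j)).stronglyMeasurable
  have hcle : ∀ (j : ℕ) (x : Fin d → ℝ), max 0 (min (α x) j) ≤ (j : ℝ) := fun j x =>
    max_le (Nat.cast_nonneg _) (min_le_right _ _)
  have hcint : ∀ j, IntegrableOn (c j) Ω := by
    intro j
    have : IsFiniteMeasure (volume.restrict Ω) := ⟨by simpa using hΩf.lt_top⟩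
    refine Integrable.of_bound (hcsm j).aestronglyMeasurable j (Eventually.of_forall fun x => ?_)
    refine (ContinuousMap.norm_le _ (Nat.cast_nonneg _)).2 fun t => ?_
    exact (abs_of_nonneg (le_max_left (0 : ℝ) _)).trans_le (hcle j x)
  have hg : ∀ j, Continuous (g j) := fun j => continuous_abs.mul (continuous_plateau _)
  have hgs : ∀ j, HasCompactSupport (g j) := by
    intro j
    refine HasCompactSupport.intro (isCompact_closedBall (0 : ℝ) (j + 1)) fun z hz => ?_
    rw [mem_closedBall_zero_iff, not_le, Real.norm_eq_abs] at hz
    simp only [g, plateau_eq_zero hz.le, mul_zero]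
  let f : ℕ → MicroTriple n d → ℝ := fun j p => c j p.1.1 (toTorus p.1.2) * g j p.2
  have hf : ∀ j p, f j p = max 0 (min (α p.1.1) j) * (|p.2| * plateau j p.2) := fun _ _ => rfl
  have hfm : ∀ j, Measurable (f j) := fun j =>
    (stronglyMeasurable_eval_toTorus (hcsm j)).measurable.mul
      ((hg j).measurable.comp measurable_snd)
  have hf0 : ∀ j p, 0 ≤ f j p := fun j p => by
    rw [hf]
    exact mul_nonneg (le_max_left _ _) (mul_nonneg (abs_nonneg _) (plateau_nonneg _ _))
  have hfle : ∀ j p, 0 < α p.1.1 → f j p ≤ α p.1.1 * |p.2| := fun j p hp => by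
    rw [hf]
    refine mul_le_mul (max_le hp.le (min_le_left _ _)) ?_
      (mul_nonneg (abs_nonneg _) (plateau_nonneg _ _)) hp.le
    exact mul_le_of_le_one_right (abs_nonneg _) (plateau_le_one _ _)
  have hfb : ∀ j p, ‖f j p‖ ≤ j * (j + 1) := fun j p => by
    rw [Real.norm_eq_abs, abs_of_nonneg (hf0 j p), hf]
    refine mul_le_mul (hcle _ _) ?_ (mul_nonneg (abs_nonneg _) (plateau_nonneg _ _))
      (Nat.cast_nonneg _)
    rcases le_total ((j : ℝ) + 1) |p.2| with h | h
    · rw [plateau_eq_zero h, mul_zero]; positivity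
    · exact (mul_le_of_le_one_right (abs_nonneg _) (plateau_le_one _ _)).trans h
  have hle : ∀ j, ∫⁻ p, ENNReal.ofReal (f j p) ∂Q ≤ B := by
    intro j
    have hlim := hconv (c j) (hcsm j) (hcint j) (g j) (hg j) (hgs j)
    have hint : ∀ Q' : Measure (MicroTriple n d), HasSpreadMarginals C Ω Q' →
        Integrable (f j) Q' := fun Q' hQ' => by
      have := hQ'.isFiniteMeasure hC hΩf
      exact Integrable.of_bound (hfm j).aestronglyMeasurable _ (Eventually.of_forall (hfb j))
    have hbd : ∀ h, ∫ p, f j p ∂(Qs h) ≤ B.toReal := by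
      intro h
      rw [integral_eq_lintegral_of_nonneg_ae (Eventually.of_forall (hf0 j))
        (hfm j).aestronglyMeasurable]
      refine ENNReal.toReal_mono hB ((lintegral_mono_ae ?_).trans (hbound h))
      filter_upwards [hα0 _ (hQs h)] with p hp
      exact ENNReal.ofReal_le_ofReal (hfle j p hp)
    rw [← ofReal_integral_eq_lintegral_ofReal (hint _ hQ) (Eventually.of_forall (hf0 j))]
    exact ENNReal.ofReal_le_of_le_toReal (le_of_tendsto' hlim hbd)
  have hfatou : ∫⁻ p, ENNReal.ofReal (α p.1.1 * |p.2|) ∂Q ≤ B := by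
    calc ∫⁻ p, ENNReal.ofReal (α p.1.1 * |p.2|) ∂Q
        = ∫⁻ p, liminf (fun j => ENNReal.ofReal (f j p)) atTop ∂Q := by
          refine lintegral_congr_ae ?_
          filter_upwards [hα0 _ hQ] with p hp
          refine (Tendsto.liminf_eq (tendsto_const_nhds.congr' ?_)).symm
          filter_upwards [eventually_plateau_eq_one p.2, eventually_ge_atTop ⌈α p.1.1⌉₊]
            with j hj hj'
          have h1 : α p.1.1 ≤ j := (Nat.le_ceil _).trans (by exact_mod_cast hj')
          rw [hf, hj, min_eq_left h1, max_eq_right hp.le, mul_one]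
      _ ≤ liminf (fun j => ∫⁻ p, ENNReal.ofReal (f j p) ∂Q) atTop :=
          lintegral_liminf_le fun j => (hfm j).ennreal_ofReal
      _ ≤ liminf (fun _ : ℕ => B) atTop := liminf_le_liminf (Eventually.of_forall hle)
      _ = B := liminf_const B
  have hnn : 0 ≤ᵐ[Q] fun p : MicroTriple n d => α p.1.1 * |p.2| := by
    filter_upwards [hα0 _ hQ] with p hp using mul_nonneg hp.le (abs_nonneg _)
  exact (lintegral_ofReal_ne_top_iff_integrable hm.aestronglyMeasurable hnn).1
    (hfatou.trans_lt hB.lt_top).ne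

lemma IsAdmissible.clamp {ψ : (Fin d → ℝ) → (Fin n → Fin d → ℝ) → ℝ} (hψ : IsAdmissible Ω ψ)
    (L : ℝ) : IsAdmissible Ω fun x y => max (-L) (min (ψ x y) L) := by
  intro δ hδ
  obtain ⟨X, Y, hX, hXΩ, hXδ, hY, hYc, hYδ, hc⟩ := hψ δ hδ
  refine ⟨X, Y, hX, hXΩ, hXδ, hY, hYc, hYδ, ?_⟩
  exact continuousOn_const.sup (hc.inf continuousOn_const)

/-- Convergence of `∫ ψ(x, y) z` for admissible `ψ` dominated by `α`, under uniform integrability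
of `α(x) z`. -/
theorem TestConvergence.tendsto_integral_mul (hconv : TestConvergence Ω Qs Q)
    (hΩ : MeasurableSet Ω) (hΩf : volume Ω ≠ ∞) (hC : C ≠ ∞)
    (hQs : ∀ h, HasSpreadMarginals C Ω (Qs h)) (hQ : HasSpreadMarginals C Ω Q)
    {ψ : (Fin d → ℝ) → (Fin n → Fin d → ℝ) → ℝ} (hψ : IsAdmissible Ω ψ)
    {α : (Fin d → ℝ) → ℝ} (hαm : Measurable α)
    (hψα : ∀ᵐ x ∂(volume.restrict Ω), ∀ y ∈ unitCellPow n d, |ψ x y| ≤ α x)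
    (hQsi : ∀ h, Integrable (fun p : MicroTriple n d => α p.1.1 * |p.2|) (Qs h))
    (hQi : Integrable (fun p : MicroTriple n d => α p.1.1 * |p.2|) Q)
    (htail : ∀ e : ℝ, 0 < e → ∃ J : ℕ, ∀ j : ℕ, J ≤ j → ∀ h,
      ∫⁻ p in {p : MicroTriple n d | (j : ℝ) < α p.1.1 ∨ (j : ℝ) < |p.2|},
        ENNReal.ofReal (α p.1.1 * |p.2|) ∂(Qs h) ≤ ENNReal.ofReal e) :
    Tendsto (fun h => ∫ p, ψ p.1.1 p.1.2 * p.2 ∂(Qs h)) atTop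
      (𝓝 (∫ p, ψ p.1.1 p.1.2 * p.2 ∂Q)) := by
  let ψ' : ℕ → (Fin d → ℝ) → (Fin n → Fin d → ℝ) → ℝ := fun j x y =>
    max (-(j : ℝ)) (min (ψ x y) j)
  let g : ℕ → ℝ → ℝ := fun j z => z * plateau j z
  have hg : ∀ j, Continuous (g j) := fun j => continuous_id.mul (continuous_plateau _)
  have hgs : ∀ j, HasCompactSupport (g j) := by
    intro j
    refine HasCompactSupport.intro (isCompact_closedBall (0 : ℝ) (j + 1)) fun z hz => ?_
    rw [mem_closedBall_zero_iff, not_le, Real.norm_eq_abs] at hz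
    simp only [g, plateau_eq_zero hz.le, mul_zero]
  have hgle : ∀ j z, |g j z| ≤ |z| := fun j z => by
    simp only [g, abs_mul, abs_of_nonneg (plateau_nonneg _ _)]
    exact mul_le_of_le_one_right (abs_nonneg _) (plateau_le_one _ _)
  have hψ'le : ∀ (j : ℕ) x y, |ψ' j x y| ≤ |ψ x y| := by
    intro j x y
    have hj : (0 : ℝ) ≤ j := Nat.cast_nonneg j
    rw [abs_le]
    refine ⟨?_, max_le (by linarith [abs_nonneg (ψ x y)]) ((min_le_left _ _).trans (le_abs_self _))⟩
    exact (le_min (neg_abs_le _) (by linarith [abs_nonneg (ψ x y)])).trans (le_max_right _ _)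
  have hψ'j : ∀ (j : ℕ) x y, |ψ' j x y| ≤ j := fun j x y => by
    have hj : (0 : ℝ) ≤ j := Nat.cast_nonneg j
    exact abs_le.2 ⟨le_max_left _ _, max_le (by linarith) (min_le_right _ _)⟩
  have hψ'eq : ∀ (j : ℕ) x y, |ψ x y| ≤ j → ψ' j x y = ψ x y := fun j x y h => by
    simp only [ψ', min_eq_left (abs_le.1 h).2, max_eq_right (abs_le.1 h).1]
  have hae : ∀ Q' : Measure (MicroTriple n d), HasSpreadMarginals C Ω Q' →
      ∀ᵐ p ∂Q', |ψ p.1.1 p.1.2| ≤ α p.1.1 := fun Q' hQ' => by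
    filter_upwards [hQ'.ae_mem hΩ, hQ'.ae_of_ae_fst hψα] with p h1 h2 using h2 _ h1.2
  have hm : ∀ Q' : Measure (MicroTriple n d), HasSpreadMarginals C Ω Q' →
      AEStronglyMeasurable (fun p : MicroTriple n d => ψ p.1.1 p.1.2 * p.2) Q' :=
    fun Q' hQ' => (hQ'.aestronglyMeasurable hC hψ).mul continuous_snd.aestronglyMeasurable
  have hm' : ∀ j, ∀ Q' : Measure (MicroTriple n d), HasSpreadMarginals C Ω Q' →
      AEStronglyMeasurable (fun p : MicroTriple n d => ψ' j p.1.1 p.1.2 * g j p.2) Q' :=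
    fun j Q' hQ' => (hQ'.aestronglyMeasurable hC (hψ.clamp j)).mul
      ((hg j).comp continuous_snd).aestronglyMeasurable
  have hdom : ∀ j, ∀ p : MicroTriple n d, |ψ p.1.1 p.1.2| ≤ α p.1.1 →
      ‖ψ' j p.1.1 p.1.2 * g j p.2‖ ≤ α p.1.1 * |p.2| := fun j p hp => by
    rw [norm_mul]
    exact mul_le_mul ((hψ'le _ _ _).trans hp) (hgle _ _) (norm_nonneg _) ((abs_nonneg _).trans hp)
  have hdom' : ∀ p : MicroTriple n d, |ψ p.1.1 p.1.2| ≤ α p.1.1 →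
      ‖ψ p.1.1 p.1.2 * p.2‖ ≤ α p.1.1 * |p.2| := fun p hp => by
    rw [norm_mul]
    exact mul_le_mul hp le_rfl (norm_nonneg _) ((abs_nonneg _).trans hp)
  have hgood : ∀ (j : ℕ) (p : MicroTriple n d), |ψ p.1.1 p.1.2| ≤ α p.1.1 → α p.1.1 ≤ j →
      |p.2| ≤ j → ψ' j p.1.1 p.1.2 * g j p.2 = ψ p.1.1 p.1.2 * p.2 := fun j p h1 h2 h3 => by
    simp only [g, hψ'eq j _ _ (h1.trans h2), plateau_eq_one h3, mul_one]
  -- Interchange of limits: the truncated integrals approach the full ones uniformly in h as j → ∞,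
  -- each truncated integral converges in h, and the truncated limits converge by domination.
  refine TendstoUniformly.tendsto_of_eventually_tendsto (p := (atTop : Filter ℕ))
    (F := fun j h => ∫ p, ψ' j p.1.1 p.1.2 * g j p.2 ∂(Qs h))
    (L := fun j => ∫ p, ψ' j p.1.1 p.1.2 * g j p.2 ∂Q) ?_ ?_ ?_
  · rw [Metric.tendstoUniformly_iff]
    intro e he
    obtain ⟨J, hJ⟩ := htail (e / 3) (by positivity)
    filter_upwards [eventually_ge_atTop J] with j hj h
    have hψi : Integrable (fun p : MicroTriple n d => ψ p.1.1 p.1.2 * p.2) (Qs h) :=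
      (hQsi h).mono' (hm _ (hQs h)) (by
        filter_upwards [hae _ (hQs h)] with p hp using hdom' p hp)
    have hψ'i : Integrable (fun p : MicroTriple n d => ψ' j p.1.1 p.1.2 * g j p.2) (Qs h) :=
      (hQsi h).mono' (hm' j _ (hQs h)) (by
        filter_upwards [hae _ (hQs h)] with p hp using hdom j p hp)
    have hT : MeasurableSet {p : MicroTriple n d | (j : ℝ) < α p.1.1 ∨ (j : ℝ) < |p.2|} := by
      rw [ofPred_or]
      exact (measurableSet_lt (by fun_prop) (by fun_prop)).union
        (measurableSet_lt (by fun_prop) (by fun_prop))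
    -- Truncation changes nothing where α ≤ j and |z| ≤ j; elsewhere it costs at most 2α|z|.
    have hlint : ∫⁻ p, ENNReal.ofReal ‖ψ p.1.1 p.1.2 * p.2 - ψ' j p.1.1 p.1.2 * g j p.2‖ ∂(Qs h)
        ≤ ENNReal.ofReal (2 * (e / 3)) := by
      calc _ ≤ ∫⁻ p, {p : MicroTriple n d | (j : ℝ) < α p.1.1 ∨ (j : ℝ) < |p.2|}.indicator
              (fun p => 2 * ENNReal.ofReal (α p.1.1 * |p.2|)) p ∂(Qs h) := by
            refine lintegral_mono_ae ?_
            filter_upwards [hae _ (hQs h)] with p hp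
            by_cases hpT : (j : ℝ) < α p.1.1 ∨ (j : ℝ) < |p.2|
            · rw [indicator_of_mem (by exact hpT)]
              rw [← ENNReal.ofReal_ofNat 2, ← ENNReal.ofReal_mul (by norm_num)]
              refine ENNReal.ofReal_le_ofReal ((norm_sub_le _ _).trans ?_)
              linarith [hdom j p hp, hdom' p hp]
            · rw [indicator_of_notMem (by exact hpT)]
              push Not at hpT
              rw [hgood j p hp hpT.1 hpT.2, sub_self, norm_zero, ENNReal.ofReal_zero]
        _ = 2 * ∫⁻ p in {p : MicroTriple n d | (j : ℝ) < α p.1.1 ∨ (j : ℝ) < |p.2|},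
              ENNReal.ofReal (α p.1.1 * |p.2|) ∂(Qs h) := by
            rw [lintegral_indicator hT, lintegral_const_mul _ (by fun_prop)]
        _ ≤ 2 * ENNReal.ofReal (e / 3) := by gcongr; exact hJ j hj h
        _ = ENNReal.ofReal (2 * (e / 3)) := by
            rw [ENNReal.ofReal_mul (by norm_num), ENNReal.ofReal_ofNat]
    rw [Real.dist_eq, ← integral_sub hψi hψ'i]
    calc _ ≤ (∫⁻ p, ENNReal.ofReal
            ‖ψ p.1.1 p.1.2 * p.2 - ψ' j p.1.1 p.1.2 * g j p.2‖ ∂(Qs h)).toReal :=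
          norm_integral_le_lintegral_norm _
      _ ≤ 2 * (e / 3) := ENNReal.toReal_le_of_le_ofReal (by positivity) hlint
      _ < e := by linarith
  · exact Eventually.of_forall fun j => hconv.tendsto_integral_of_bounded hΩ hΩf hC hQs hQ
      (hψ.clamp j) (Nat.cast_nonneg j) (fun x _ y _ => hψ'j j x y) (hg j) (hgs j)
  · refine tendsto_integral_of_dominated_convergence (fun p => α p.1.1 * |p.2|)
      (fun j => hm' j _ hQ) hQi (fun j => ?_) ?_
    · filter_upwards [hae _ hQ] with p hp using hdom j p hp
    · filter_upwards [hae _ hQ] with p hp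
      refine tendsto_const_nhds.congr' ?_
      filter_upwards [eventually_ge_atTop ⌈|p.2|⌉₊, eventually_ge_atTop ⌈α p.1.1⌉₊] with j h1 h2
      exact (hgood j p hp ((Nat.le_ceil _).trans (by exact_mod_cast h2))
        ((Nat.le_ceil _).trans (by exact_mod_cast h1))).symm

end Limits

/-! ### Uniform integrability from Hölder's inequality. -/

section UniformIntegrability

variable {X ι : Type*} [MeasurableSpace X] {m : Measure X}

lemma exists_forall_measure_lt_abs_le {f : ι → X → ℝ}
    (hf : ∀ i, AEStronglyMeasurable (f i) m) {B : ℝ≥0∞} (hB : B ≠ ∞)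
    (hfB : ∀ i, eLpNorm (f i) 1 m ≤ B) {δ : ℝ} (hδ : 0 < δ) :
    ∃ J : ℕ, ∀ j : ℕ, J ≤ j → ∀ i, m {x | (j : ℝ) < |f i x|} ≤ ENNReal.ofReal δ := by
  -- Markov's inequality gives B/j ≤ δ for j ≥ B/δ; the extra 1 makes j positive, so that it can be
  -- cancelled.
  refine ⟨⌈B.toReal / δ⌉₊ + 1, fun j hj i => ?_⟩
  have hj1 : (1 : ℝ) ≤ j := by exact_mod_cast (Nat.le_add_left 1 _).trans hj
  have hj2 : B.toReal / δ ≤ j :=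
    (Nat.le_ceil _).trans (by exact_mod_cast (Nat.le_succ _).trans hj)
  have hBj : B ≤ ENNReal.ofReal (j * δ) := by
    rw [← ENNReal.ofReal_toReal hB]
    exact ENNReal.ofReal_le_ofReal ((div_le_iff₀ hδ).1 hj2)
  have h1 : ENNReal.ofReal j * m {x | ENNReal.ofReal j ≤ ‖f i x‖ₑ} ≤ ENNReal.ofReal (j * δ) := by
    refine (mul_meas_ge_le_lintegral₀ (hf i).enorm _).trans (le_trans ?_ hBj)
    rw [← eLpNorm_one_eq_lintegral_enorm]
    exact hfB i
  rw [ENNReal.ofReal_mul (by positivity)] at h1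
  have h2 := (ENNReal.mul_le_mul_iff_right (ENNReal.ofReal_pos.2 (by linarith)).ne'
    ENNReal.ofReal_ne_top).1 h1
  refine (measure_mono fun x hx => ?_).trans h2
  change ENNReal.ofReal j ≤ ‖f i x‖ₑ
  rw [← ofReal_norm]
  exact ENNReal.ofReal_le_ofReal (le_of_lt hx)

lemma setLIntegral_mul_abs_le {q q' : ℝ≥0∞} (hqq' : q.HolderConjugate q') {α u : X → ℝ}
    (hα : AEStronglyMeasurable α m) (hu : AEStronglyMeasurable u m) {s : Set X}
    (hs : MeasurableSet s) :
    ∫⁻ x in s, ENNReal.ofReal (α x * |u x|) ∂m ≤ eLpNorm (s.indicator α) q' m * eLpNorm u q m := by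
  have hqq'' : q'.HolderConjugate q := hqq'.symm
  calc ∫⁻ x in s, ENNReal.ofReal (α x * |u x|) ∂m
      = ∫⁻ x, s.indicator (fun x => ENNReal.ofReal (α x * |u x|)) x ∂m :=
        (lintegral_indicator hs _).symm
    _ ≤ ∫⁻ x, ‖(s.indicator α • u) x‖ₑ ∂m := by
        refine lintegral_mono fun x => ?_
        by_cases hx : x ∈ s
        · simp only [hx, indicator_of_mem, Pi.smul_apply', smul_eq_mul]
          rw [← ofReal_norm, norm_mul]
          exact ENNReal.ofReal_le_ofReal
            (mul_le_mul_of_nonneg_right (le_abs_self _) (abs_nonneg _))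
        · simp [hx]
    _ = eLpNorm (s.indicator α • u) 1 m := eLpNorm_one_eq_lintegral_enorm.symm
    _ ≤ _ := eLpNorm_smul_le_mul_eLpNorm hu (hα.indicator hs)

/-- Uniform integrability of the products of a fixed function in `L^{q'}` with the members of a
bounded family in `L^q`, `1 < q`. -/
lemma exists_forall_setLIntegral_mul_abs_le [IsFiniteMeasure m] {q q' : ℝ≥0∞} (hq : 1 < q)
    (hqq' : q.HolderConjugate q') {α : X → ℝ} (hαm : Measurable α) (hα : MemLp α q' m)
    {u : ι → X → ℝ} (hum : ∀ i, Measurable (u i)) {B : ℝ≥0∞} (hB : B ≠ ∞)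
    (hu : ∀ i, eLpNorm (u i) q m ≤ B) {e : ℝ} (he : 0 < e) :
    ∃ J : ℕ, ∀ j : ℕ, J ≤ j → ∀ i, ∫⁻ x in {x | (j : ℝ) < α x ∨ (j : ℝ) < |u i x|},
      ENNReal.ofReal (α x * |u i x|) ∂m ≤ ENNReal.ofReal e := by
  have hqq'' : q'.HolderConjugate q := hqq'.symm
  have hq'1 : 1 ≤ q' := ENNReal.HolderConjugate.one_le q' q
  have hq'top : q' ≠ ∞ := fun h =>
    hq.ne' ((ENNReal.HolderConjugate.eq_top_iff_eq_one q' q).1 h)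
  -- Absolute continuity of the L^{q'} norm of α, which requires q' < ∞. The tolerance e/(B + 1)
  -- absorbs the factor B from the L^q norm of u.
  obtain ⟨δ, hδ, hδα⟩ := hα.eLpNorm_indicator_le hq'1 hq'top
    (show 0 < e / (B.toReal + 1) by positivity)
  have hα1 : eLpNorm α 1 m ≠ ∞ := (hα.mono_exponent hq'1).eLpNorm_ne_top
  obtain ⟨J₁, hJ₁⟩ := exists_forall_measure_lt_abs_le (f := fun _ : Unit => α)
    (fun _ => hα.1) hα1 (fun _ => le_rfl) (half_pos hδ)
  obtain ⟨J₂, hJ₂⟩ := exists_forall_measure_lt_abs_le (f := u) (m := m)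
    (B := B * m univ ^ (1 / (1 : ℝ≥0∞).toReal - 1 / q.toReal))
    (fun i => (hum i).aestronglyMeasurable)
    (by
      refine ENNReal.mul_ne_top hB (ENNReal.rpow_ne_top_of_nonneg ?_ (measure_ne_top _ _))
      rw [ENNReal.toReal_one, div_one, sub_nonneg]
      -- At q = ∞ the real value of q is 0 and 1/0 = 0, so the exponent 1 - 1/q is 1, as it should
      -- be.
      rcases eq_or_ne q ∞ with rfl | hqt
      · simp
      · have : 1 ≤ q.toReal := by simpa using ENNReal.toReal_mono hqt hq.le
        exact (div_le_one (by linarith)).2 this)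
    (fun i => (eLpNorm_le_eLpNorm_mul_rpow_measure_univ hq.le
      (hum i).aestronglyMeasurable).trans (by gcongr; exact hu i)) (half_pos hδ)
  refine ⟨max J₁ J₂, fun j hj i => ?_⟩
  have hs : MeasurableSet {x | (j : ℝ) < α x ∨ (j : ℝ) < |u i x|} := by
    rw [ofPred_or]
    have := hum i
    exact (measurableSet_lt (by fun_prop) (by fun_prop)).union
      (measurableSet_lt (by fun_prop) (by fun_prop))
  have hms : m {x | (j : ℝ) < α x ∨ (j : ℝ) < |u i x|} ≤ ENNReal.ofReal δ := by
    calc _ ≤ m ({x | (j : ℝ) < |α x|} ∪ {x | (j : ℝ) < |u i x|}) :=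
          measure_mono fun x hx => hx.imp (fun h => lt_of_lt_of_le h (le_abs_self _)) id
      _ ≤ ENNReal.ofReal (δ / 2) + ENNReal.ofReal (δ / 2) :=
          (measure_union_le _ _).trans (add_le_add (hJ₁ j ((le_max_left _ _).trans hj) ())
            (hJ₂ j ((le_max_right _ _).trans hj) i))
      _ = ENNReal.ofReal δ := by
          rw [← ENNReal.ofReal_add (by positivity) (by positivity), add_halves]
  calc _ ≤ eLpNorm ({x | (j : ℝ) < α x ∨ (j : ℝ) < |u i x|}.indicator α) q' m
          * eLpNorm (u i) q m :=
        setLIntegral_mul_abs_le hqq' hα.1 (hum i).aestronglyMeasurable hs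
    _ ≤ ENNReal.ofReal (e / (B.toReal + 1)) * B := by
        gcongr
        · exact hδα _ hs hms
        · exact hu i
    _ = ENNReal.ofReal (e / (B.toReal + 1) * B.toReal) := by
        rw [ENNReal.ofReal_mul (by positivity), ENNReal.ofReal_toReal hB]
    _ ≤ ENNReal.ofReal e := by
        refine ENNReal.ofReal_le_ofReal ?_
        rw [div_mul_eq_mul_div, div_le_iff₀ (by positivity)]
        nlinarith [ENNReal.toReal_nonneg (a := B)]

end UniformIntegrability

/-! ### Spread marginals of the oscillating laws and of the limit. -/

section MicroMeasures

variable {n d : ℕ} {C C' : ℝ≥0∞} {Ω : Set (Fin d → ℝ)} {ρ : Fin n → ℝ → ℝ} {ε : ℕ → ℝ}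

lemma HasSpreadMarginals.mono {Q : Measure (MicroTriple n d)} (hQ : HasSpreadMarginals C Ω Q)
    (hCC' : C ≤ C') : HasSpreadMarginals C' Ω Q :=
  ⟨fun B hB => (hQ.macro_le B hB).trans (by gcongr),
    fun k B hB => (hQ.micro_le k B hB).trans (by gcongr)⟩

lemma IsScaleFamily.tendsto_zero_comp (hρ : IsScaleFamily ρ) (hεpos : ∀ h, 0 < ε h)
    (hε : Tendsto ε atTop (𝓝 0)) (k : Fin n) : Tendsto (fun h => ρ k (ε h)) atTop (𝓝 0) :=
  (hρ.tendsto_zero k).comp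
    (tendsto_nhdsWithin_iff.2 ⟨hε, Eventually.of_forall hεpos⟩)

lemma IsScaleFamily.exists_bound (hρ : IsScaleFamily ρ) (hεpos : ∀ h, 0 < ε h)
    (hε : Tendsto ε atTop (𝓝 0)) : ∃ M, ∀ k h, ρ k (ε h) ≤ M := by
  choose M hM using fun k => (hρ.tendsto_zero_comp hεpos hε k).bddAbove_range
  refine ⟨∑ k, |M k|, fun k h => ?_⟩
  exact (hM k (mem_range_self h)).trans ((le_abs_self _).trans
    (Finset.single_le_sum (f := fun k => |M k|) (fun _ _ => abs_nonneg _) (Finset.mem_univ k)))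

/-- The distribution of `((x, v_h(x)), u(x))` for `x ∈ Ω`. -/
noncomputable def oscMeasure (Ω : Set (Fin d → ℝ)) (ρ : Fin n → ℝ → ℝ) (ε : ℕ → ℝ) (h : ℕ)
    (u : (Fin d → ℝ) → ℝ) : Measure (MicroTriple n d) :=
  (volume.restrict Ω).map fun x => ((x, oscVar ρ ε h x), u x)

lemma measurable_oscTriple (ρ : Fin n → ℝ → ℝ) (ε : ℕ → ℝ) (h : ℕ)
    {u : (Fin d → ℝ) → ℝ} (hu : Measurable u) :
    Measurable fun x => (((x, oscVar ρ ε h x), u x) : MicroTriple n d) := by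
  have := measurable_oscVar (d := d) ρ ε h
  fun_prop

/-- The x-marginal is Lebesgue measure on Ω, and the y_k-marginals follow from counting cells. The
constant does not depend on h because the scales stay bounded along ε_h. -/
lemma exists_hasSpreadMarginals_oscMeasure (hΩb : Bornology.IsBounded Ω)
    (hρ : IsScaleFamily ρ) (hεpos : ∀ h, 0 < ε h) (hε : Tendsto ε atTop (𝓝 0)) :
    ∃ C : ℝ≥0∞, C ≠ ∞ ∧ ∀ h (u : (Fin d → ℝ) → ℝ), Measurable u →
      HasSpreadMarginals C Ω (oscMeasure Ω ρ ε h u) := by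
  obtain ⟨M, hM⟩ := hρ.exists_bound hεpos hε
  obtain ⟨R, hR0, hR⟩ := hΩb.exists_pos_norm_le
  have hR' : ∀ x ∈ Ω, ∀ i, |x i| ≤ R := fun x hx i => (norm_le_pi_norm x i).trans (hR x hx)
  refine ⟨1 + ENNReal.ofReal ((2 * R + 3 * M) ^ d), by finiteness, fun h u hu => ⟨?_, ?_⟩⟩
  · intro B hB
    have hm : MeasurableSet {p : MicroTriple n d | p.1.1 ∈ B} :=
      (measurable_fst.comp measurable_fst) hB
    rw [oscMeasure, Measure.map_apply (measurable_oscTriple ρ ε h hu) hm]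
    have : (fun x => (((x, oscVar ρ ε h x), u x) : MicroTriple n d)) ⁻¹' {p | p.1.1 ∈ B} = B := rfl
    rw [this, Measure.restrict_apply hB, inter_comm]
    exact le_mul_of_one_le_left (zero_le) le_self_add
  · intro k B hB
    have hm : MeasurableSet {p : MicroTriple n d | p.1.2 k ∈ B} :=
      ((measurable_pi_apply k).comp (measurable_snd.comp measurable_fst)) hB
    rw [oscMeasure, Measure.map_apply (measurable_oscTriple ρ ε h hu) hm,
      Measure.restrict_apply (measurable_oscTriple ρ ε h hu hm), inter_comm]
    exact (volume_inter_fract_le hR' hR0.le (hρ.pos k _ (hεpos h)) (hM k h) B).trans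
      (by gcongr; exact le_add_self)

lemma hasSpreadMarginals_macroMicro_compProd
    (κ : Kernel ((Fin d → ℝ) × (Fin n → Fin d → ℝ)) ℝ) [IsMarkovKernel κ] :
    HasSpreadMarginals (1 + volume Ω) Ω (macroMicro n Ω ⊗ₘ κ) := by
  have hSF : SFinite (macroMicro n Ω) := by unfold macroMicro; infer_instance
  have key : ∀ A : Set ((Fin d → ℝ) × (Fin n → Fin d → ℝ)), MeasurableSet A →
      (macroMicro n Ω ⊗ₘ κ) (Prod.fst ⁻¹' A) = volume (A ∩ Ω ×ˢ unitCellPow n d) := by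
    intro A hA
    rw [← Measure.fst_apply hA, Measure.fst_compProd, macroMicro, Measure.restrict_apply hA]
  refine ⟨fun B hB => ?_, fun k B hB => ?_⟩
  · have h := key {q | q.1 ∈ B} (measurable_fst hB)
    have h2 : {q : (Fin d → ℝ) × (Fin n → Fin d → ℝ) | q.1 ∈ B} ∩ Ω ×ˢ unitCellPow n d
        = (Ω ∩ B) ×ˢ unitCellPow n d := by
      ext q; simp only [mem_inter_iff, mem_ofPred_eq, mem_prod]; tauto
    rw [h2, Measure.volume_eq_prod, Measure.prod_prod, volume_unitCellPow, mul_one] at h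
    exact h.trans_le (le_mul_of_one_le_left zero_le le_self_add)
  · have h := key {q | q.2 k ∈ B} (((measurable_pi_apply k).comp measurable_snd) hB)
    have h2 : {q : (Fin d → ℝ) × (Fin n → Fin d → ℝ) | q.2 k ∈ B} ∩ Ω ×ˢ unitCellPow n d
        = Ω ×ˢ Set.pi univ (Function.update (fun _ => unitCell d) k (unitCell d ∩ B)) := by
      ext q
      simp only [mem_inter_iff, mem_ofPred_eq, mem_prod, unitCellPow, mem_univ_pi]
      constructor
      · rintro ⟨h1, h2, h3⟩
        refine ⟨h2, fun j => ?_⟩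
        rcases eq_or_ne j k with rfl | hj
        · simpa using ⟨h3 j, h1⟩
        · simpa [hj] using h3 j
      · rintro ⟨h1, h2⟩
        have hk := h2 k
        rw [Function.update_self] at hk
        refine ⟨hk.2, h1, fun j => ?_⟩
        rcases eq_or_ne j k with rfl | hj
        · exact hk.1
        · simpa [hj] using h2 j
    have h3 : volume (Set.pi univ (Function.update (fun _ : Fin n => unitCell d) k
        (unitCell d ∩ B))) = volume (unitCell d ∩ B) := by
      rw [volume_pi_pi, Finset.prod_eq_single k]
      · simp
      · intro j _ hj; simp [hj, volume_unitCell]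
      · simp
    rw [h2, Measure.volume_eq_prod, Measure.prod_prod, h3] at h
    exact h.trans_le (by gcongr; exact le_add_self)

end MicroMeasures

/-! ### Proof of (a). -/

section MeanValue

variable {n d : ℕ} {Ω : Set (Fin d → ℝ)} {ρ : Fin n → ℝ → ℝ} {ε : ℕ → ℝ}

theorem GeneratesMultiscaleYoungMeasure.mean_value (hΩ : IsOpen Ω) (hΩb : Bornology.IsBounded Ω)
    (hρ : IsScaleFamily ρ) (hεpos : ∀ h, 0 < ε h) (hε : Tendsto ε atTop (𝓝 0))
    {q q' : ℝ≥0∞} (hq : 1 < q) (hqq' : q.HolderConjugate q') {u : ℕ → (Fin d → ℝ) → ℝ}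
    (hu : ∀ h, MemLp (u h) q (volume.restrict Ω))
    (huB : ∃ C : ℝ≥0∞, C ≠ ∞ ∧ ∀ h, eLpNorm (u h) q (volume.restrict Ω) ≤ C)
    {ν : (Fin d → ℝ) × (Fin n → Fin d → ℝ) → Measure ℝ}
    (hν : GeneratesMultiscaleYoungMeasure Ω ρ ε u ν)
    {ψ : (Fin d → ℝ) → (Fin n → Fin d → ℝ) → ℝ} (hψ : IsAdm q' Ω ψ) :
    (∀ h, IntegrableOn (fun x => ψ x (oscVar ρ ε h x) * u h x) Ω) ∧
    (∀ᵐ p ∂(macroMicro n Ω), Integrable (fun z : ℝ => z) (ν p)) ∧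
    Integrable (fun p => ψ p.1 p.2 * barycenter ν p) (macroMicro n Ω) ∧
    Tendsto (fun h => ∫ x in Ω, ψ x (oscVar ρ ε h x) * u h x) atTop
      (𝓝 (∫ p, ψ p.1 p.2 * barycenter ν p ∂(macroMicro n Ω))) := by
  have hSF : SFinite (macroMicro n Ω) := by unfold macroMicro; infer_instance
  have hΩm := hΩ.measurableSet
  have hΩf : volume Ω ≠ ∞ := hΩb.measure_lt_top.ne
  have hfin : IsFiniteMeasure (volume.restrict Ω) := ⟨by simpa using hΩf.lt_top⟩
  obtain ⟨B, hB, huB⟩ := huB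
  obtain ⟨hadm, α₀, hα₀, hα₀pos, hα₀ψ⟩ := hψ
  obtain ⟨α, hαm, hαe⟩ : ∃ α : (Fin d → ℝ) → ℝ, Measurable α ∧ α₀ =ᵐ[volume.restrict Ω] α :=
    hα₀.1.aemeasurable
  have hα : MemLp α q' (volume.restrict Ω) := hα₀.ae_eq hαe
  have hαpos : ∀ᵐ x ∂(volume.restrict Ω), 0 < α x := by
    filter_upwards [hαe, ae_restrict_mem hΩm] with x hx hxΩ using hx ▸ hα₀pos x hxΩ
  have hαψ : ∀ᵐ x ∂(volume.restrict Ω), ∀ y ∈ unitCellPow n d, |ψ x y| ≤ α x := by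
    filter_upwards [hαe, ae_restrict_mem hΩm] with x hx hxΩ using hx ▸ hα₀ψ x hxΩ
  -- Measurable representatives make the map to triples measurable, so that image measures can be
  -- used; all the integrals are unchanged.
  choose u' hum' hue' using fun h => (hu h).1.aemeasurable
  have huB' : ∀ h, eLpNorm (u' h) q (volume.restrict Ω) ≤ B := fun h =>
    (eLpNorm_congr_ae (hue' h)).symm.trans_le (huB h)
  obtain ⟨κ, hκ, hκν⟩ := hν.1.exists_kernel
  let Qs : ℕ → Measure (MicroTriple n d) := fun h => oscMeasure Ω ρ ε h (u' h)
  let Q : Measure (MicroTriple n d) := macroMicro n Ω ⊗ₘ κ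
  have hW : ∀ h, Measurable fun x => (((x, oscVar ρ ε h x), u' h x) : MicroTriple n d) :=
    fun h => measurable_oscTriple ρ ε h (hum' h)
  obtain ⟨C₀, hC₀, hC₀s⟩ := exists_hasSpreadMarginals_oscMeasure hΩb hρ hεpos hε
  let C : ℝ≥0∞ := C₀ + (1 + volume Ω)
  have hC : C ≠ ∞ := by finiteness
  have hQs : ∀ h, HasSpreadMarginals C Ω (Qs h) := fun h =>
    (hC₀s h _ (hum' h)).mono le_self_add
  have hQ : HasSpreadMarginals C Ω Q :=
    (hasSpreadMarginals_macroMicro_compProd κ).mono le_add_self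
  have hconv : TestConvergence Ω Qs Q := by
    intro c hcsm hcint g hg hgs
    refine (hν.tendsto_integral hκν hcsm hcint hg hgs).congr fun h => ?_
    have hsm : StronglyMeasurable fun p : MicroTriple n d => c p.1.1 (toTorus p.1.2) * g p.2 :=
      (stronglyMeasurable_eval_toTorus hcsm).mul
        (hg.measurable.comp measurable_snd).stronglyMeasurable
    simp only [Qs, oscMeasure]
    rw [integral_map (hW h).aemeasurable hsm.aestronglyMeasurable]
    refine integral_congr_ae ?_
    filter_upwards [hue' h] with x hx
    rw [hx]
  have hlint : ∀ h, ∫⁻ p, ENNReal.ofReal (α p.1.1 * |p.2|) ∂(Qs h)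
      ≤ eLpNorm α q' (volume.restrict Ω) * B := by
    intro h
    simp only [Qs, oscMeasure]
    rw [lintegral_map (by fun_prop) (hW h)]
    have := setLIntegral_mul_abs_le hqq' hα.1 (hum' h).aestronglyMeasurable MeasurableSet.univ
      (m := volume.restrict Ω)
    rw [Measure.restrict_univ, indicator_univ] at this
    exact this.trans (by gcongr; exact huB' h)
  have hbd : eLpNorm α q' (volume.restrict Ω) * B ≠ ∞ := ENNReal.mul_ne_top hα.eLpNorm_ne_top hB
  have hαz : Measurable fun p : MicroTriple n d => α p.1.1 * |p.2| := by fun_prop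
  have hQsi : ∀ h, Integrable (fun p : MicroTriple n d => α p.1.1 * |p.2|) (Qs h) := by
    intro h
    refine (lintegral_ofReal_ne_top_iff_integrable hαz.aestronglyMeasurable ?_).1
      ((hlint h).trans_lt hbd.lt_top).ne
    filter_upwards [(hQs h).ae_of_ae_fst hαpos] with p hp using mul_nonneg hp.le (abs_nonneg _)
  have hQi := hconv.integrable_mul_abs hΩf hC hQs hQ hαm hαpos hbd hlint
  have htail : ∀ e : ℝ, 0 < e → ∃ J : ℕ, ∀ j : ℕ, J ≤ j → ∀ h,
      ∫⁻ p in {p : MicroTriple n d | (j : ℝ) < α p.1.1 ∨ (j : ℝ) < |p.2|},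
        ENNReal.ofReal (α p.1.1 * |p.2|) ∂(Qs h) ≤ ENNReal.ofReal e := by
    intro e he
    obtain ⟨J, hJ⟩ := exists_forall_setLIntegral_mul_abs_le hq hqq' hαm hα hum' hB huB' he
    refine ⟨J, fun j hj h => ?_⟩
    have hT : MeasurableSet {p : MicroTriple n d | (j : ℝ) < α p.1.1 ∨ (j : ℝ) < |p.2|} := by
      rw [ofPred_or]
      exact (measurableSet_lt (by fun_prop) (by fun_prop)).union
        (measurableSet_lt (by fun_prop) (by fun_prop))
    simp only [Qs, oscMeasure]
    rw [setLIntegral_map hT (by fun_prop) (hW h)]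
    exact hJ j hj h
  have hint : ∀ Q' : Measure (MicroTriple n d), HasSpreadMarginals C Ω Q' →
      Integrable (fun p : MicroTriple n d => α p.1.1 * |p.2|) Q' →
      Integrable (fun p : MicroTriple n d => ψ p.1.1 p.1.2 * p.2) Q' := by
    intro Q' hQ' hi
    refine hi.mono' ((hQ'.aestronglyMeasurable hC hadm).mul
      continuous_snd.aestronglyMeasurable) ?_
    filter_upwards [hQ'.ae_mem hΩm, hQ'.ae_of_ae_fst hαψ] with p h1 h2
    rw [norm_mul]
    exact mul_le_mul_of_nonneg_right (h2 _ h1.2) (abs_nonneg _)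
  have hlim := hconv.tendsto_integral_mul hΩm hΩf hC hQs hQ hadm hαm hαψ hQsi hQi htail
  have hosc : ∀ h, (fun x => ψ x (oscVar ρ ε h x) * u' h x) =ᵐ[volume.restrict Ω]
      fun x => ψ x (oscVar ρ ε h x) * u h x := fun h => by
    filter_upwards [hue' h] with x hx
    rw [hx]
  have hbary : (fun p => ∫ z, ψ p.1 p.2 * z ∂(κ p)) =ᵐ[macroMicro n Ω]
      fun p => ψ p.1 p.2 * barycenter ν p := by
    filter_upwards [hκν] with p hp
    rw [integral_const_mul, hp, barycenter]
  have hiQ := hint Q hQ hQi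
  refine ⟨fun h => ?_, ?_, ?_, ?_⟩
  · have hi := (hint _ (hQs h) (hQsi h)).comp_measurable (hW h)
    exact hi.congr (hosc h)
  · have h1 := ((Measure.integrable_compProd_iff hQi.1).1 hQi).1
    have h2 : ∀ᵐ p ∂(macroMicro n Ω), 0 < α p.1 := by
      have h3 : ∀ᵐ p ∂Q, 0 < α p.1.1 := hQ.ae_of_ae_fst hαpos
      have h4 : ∀ᵐ p ∂Q.fst, 0 < α p.1 := by
        rw [Measure.fst, ae_map_iff measurable_fst.aemeasurable
          (measurableSet_lt measurable_const (by fun_prop))]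
        exact h3
      rwa [Measure.fst_compProd] at h4
    filter_upwards [h1, h2, hκν] with p hp hp' hpκ
    rw [← hpκ]
    -- For almost every (x, y) the fibre integral of α(x)|z| is finite, and positivity of α allows
    -- division by α(x).
    have h5 := (integrable_const_mul_iff (IsUnit.mk0 _ hp'.ne') _).1 hp
    exact (integrable_norm_iff measurable_id.aestronglyMeasurable).1 h5
  · exact (Integrable.integral_compProd hiQ).congr hbary
  · rw [← integral_congr_ae hbary, ← Measure.integral_compProd hiQ]
    refine hlim.congr fun h => ?_
    simp only [Qs, oscMeasure]
    rw [integral_map (hW h).aemeasurable (hint _ (hQs h) (hQsi h)).1]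
    exact integral_congr_ae (hosc h)

end MeanValue

/-! ### Divergence of the combined frequencies. -/

section Frequencies

variable {n d : ℕ} {ρ : Fin n → ℝ → ℝ} {ε : ℕ → ℝ}

lemma IsScaleFamily.tendsto_ratio (hρ : IsScaleFamily ρ) (hεpos : ∀ h, 0 < ε h)
    (hε : Tendsto ε atTop (𝓝 0)) {k l : Fin n} (hkl : k < l) :
    Tendsto (fun h => ρ l (ε h) / ρ k (ε h)) atTop (𝓝 0) := by
  have hε' : Tendsto ε atTop (𝓝[>] 0) :=
    tendsto_nhdsWithin_iff.2 ⟨hε, Eventually.of_forall hεpos⟩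
  obtain ⟨k, hk⟩ := k
  obtain ⟨l, hl⟩ := l
  have hkl' : k + 1 ≤ l := hkl
  clear hkl
  induction l, hkl' using Nat.le_induction with
  | base => exact (hρ.separated k hl).comp hε'
  | succ l hkl ih =>
    have h1 := ((hρ.separated l hl).comp hε').mul (ih (Nat.lt_of_succ_lt hl))
    rw [mul_zero] at h1
    refine h1.congr fun h => ?_
    have := (hρ.pos ⟨l, Nat.lt_of_succ_lt hl⟩ (ε h) (hεpos h)).ne'
    have := (hρ.pos ⟨k, hk⟩ (ε h) (hεpos h)).ne'
    simp only [Function.comp_apply]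
    field_simp

/-- A nontrivial integer combination of the frequencies `1 / ρ k` is unbounded. -/
lemma IsScaleFamily.tendsto_abs_sum_div (hρ : IsScaleFamily ρ) (hεpos : ∀ h, 0 < ε h)
    (hε : Tendsto ε atTop (𝓝 0)) {m : Fin n → ℤ} (hm : m ≠ 0) :
    Tendsto (fun h => |∑ k, (m k : ℝ) / ρ k (ε h)|) atTop atTop := by
  classical
  obtain ⟨k₀, hk₀⟩ := Function.ne_iff.1 hm
  -- Let K be the finest scale with m_K ≠ 0. Multiplied by ρ_K, the sum tends to m_K: coarser scales
  -- contribute vanishing ratios and finer ones zero coefficients.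
  have hne : (Finset.univ.filter fun k => m k ≠ 0).Nonempty := ⟨k₀, by simpa using hk₀⟩
  set K := (Finset.univ.filter fun k => m k ≠ 0).max' hne with hK
  have hmK : m K ≠ 0 := by simpa using Finset.max'_mem _ hne
  have hmax : ∀ k, K < k → m k = 0 := by
    intro k hk
    by_contra hcon
    exact absurd (Finset.le_max' _ k (by simpa using hcon)) (not_le.2 hk)
  have hlim : Tendsto (fun h => ∑ k, (m k : ℝ) * (ρ K (ε h) / ρ k (ε h))) atTop
      (𝓝 (∑ k, if k = K then (m K : ℝ) else 0)) := by
    refine tendsto_finsetSum _ fun k _ => ?_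
    rcases lt_trichotomy k K with hk | hk | hk
    · rw [if_neg hk.ne, ← mul_zero (m k : ℝ)]
      exact (hρ.tendsto_ratio hεpos hε hk).const_mul _
    · subst hk
      rw [if_pos rfl]
      refine tendsto_const_nhds.congr fun h => ?_
      rw [div_self (hρ.pos _ _ (hεpos h)).ne', mul_one]
    · rw [if_neg hk.ne', hmax k hk]
      simp
  rw [Finset.sum_ite_eq' Finset.univ K, if_pos (Finset.mem_univ _)] at hlim
  have hinv : Tendsto (fun h => (ρ K (ε h))⁻¹) atTop atTop :=
    tendsto_inv_nhdsGT_zero.comp (tendsto_nhdsWithin_iff.2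
      ⟨hρ.tendsto_zero_comp hεpos hε K, Eventually.of_forall fun h => hρ.pos _ _ (hεpos h)⟩)
  refine (hinv.atTop_mul_pos (by simpa using hmK) hlim.abs).congr fun h => ?_
  have hpos := hρ.pos K _ (hεpos h)
  rw [← abs_of_pos (inv_pos.2 hpos), ← abs_mul, Finset.mul_sum]
  congr 1
  refine Finset.sum_congr rfl fun k _ => ?_
  have := hpos.ne'
  have := (hρ.pos k _ (hεpos h)).ne'
  field_simp

end Frequencies

/-! ### Weyl equidistribution on the torus. -/

section Equidistribution

variable {n d : ℕ} {ρ : Fin n → ℝ → ℝ} {ε : ℕ → ℝ}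

/-- The coordinates of a point of `Tⁿ`, indexed by pairs. -/
def uncurryTorus {n d : ℕ} (t : TorusPow n d) : UnitAddTorus (Fin n × Fin d) := fun p => t p.1 p.2

lemma continuous_uncurryTorus : Continuous (uncurryTorus : TorusPow n d → _) := by
  unfold uncurryTorus; fun_prop

/-- Characters do not see integer parts, so along v_h they are plane waves in x. -/
lemma mFourier_uncurryTorus_oscVar (m : Fin n × Fin d → ℤ) (h : ℕ) (x : Fin d → ℝ) :
    UnitAddTorus.mFourier m (uncurryTorus (toTorus (oscVar ρ ε h x)))
      = Complex.exp (2 * Real.pi * (∑ p, (m p : ℝ) / ρ p.1 (ε h) * x p.2 : ℝ) * Complex.I) := by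
  simp only [UnitAddTorus.mFourier, ContinuousMap.coe_mk, uncurryTorus, toTorus, oscVar,
    AddCircle.coe_fract, fourier_coe_apply]
  rw [← Complex.exp_sum]
  congr 1
  push_cast
  rw [Finset.mul_sum, Finset.sum_mul]
  refine Finset.sum_congr rfl fun p _ => ?_
  ring

/-- The Riemann–Lebesgue lemma for the indicator of s. If m has a nonzero entry in direction i₀, the
i₀-component of the frequency is a nontrivial combination of the 1/ρ_k, hence diverges. -/
lemma tendsto_setIntegral_mFourier_oscVar (hρ : IsScaleFamily ρ) (hεpos : ∀ h, 0 < ε h)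
    (hε : Tendsto ε atTop (𝓝 0)) {m : Fin n × Fin d → ℤ} (hm : m ≠ 0) {s : Set (Fin d → ℝ)}
    (hs : MeasurableSet s) :
    Tendsto (fun h => ∫ x in s, UnitAddTorus.mFourier m (uncurryTorus (toTorus (oscVar ρ ε h x))))
      atTop (𝓝 0) := by
  let w : ℕ → StrongDual ℝ (Fin d → ℝ) := fun h =>
    -- The sign compensates the minus sign in the Fourier kernel.
    -∑ p, ((m p : ℝ) / ρ p.1 (ε h)) • ContinuousLinearMap.proj (R := ℝ) p.2
  have hw : ∀ h x, w h x = -∑ p, (m p : ℝ) / ρ p.1 (ε h) * x p.2 := by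
    intro h x
    simp [w]
  have hlim : Tendsto w atTop (cocompact _) := by
    have : ProperSpace (StrongDual ℝ (Fin d → ℝ)) := FiniteDimensional.proper ℝ _
    rw [← Metric.cobounded_eq_cocompact, ← tendsto_norm_atTop_iff_cobounded]
    obtain ⟨⟨k₀, i₀⟩, hp₀⟩ := Function.ne_iff.1 hm
    have hm' : (fun k => m (k, i₀)) ≠ 0 := Function.ne_iff.2 ⟨k₀, hp₀⟩
    refine tendsto_atTop_mono (fun h => ?_) (hρ.tendsto_abs_sum_div hεpos hε hm')
    have h1 := (w h).le_opNorm (Pi.single i₀ 1)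
    rw [Pi.norm_single, norm_one, mul_one, hw, norm_neg, Fintype.sum_prod_type] at h1
    refine le_of_eq_of_le ?_ h1
    rw [Real.norm_eq_abs]
    congr 1
    refine Finset.sum_congr rfl fun k _ => ?_
    rw [Finset.sum_eq_single i₀]
    · simp
    · intro i _ hi; simp [hi]
    · simp
  refine ((tendsto_integral_exp_smul_cocompact (s.indicator fun _ => (1 : ℂ))
    (volume : Measure (Fin d → ℝ))).comp hlim).congr fun h => ?_
  rw [← integral_indicator hs]
  refine integral_congr_ae (Eventually.of_forall fun x => ?_)
  by_cases hx : x ∈ s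
  · simp only [hx, indicator_of_mem, mFourier_uncurryTorus_oscVar, Circle.smul_def,
      Real.fourierChar_apply, smul_eq_mul, mul_one, hw, neg_neg]
    push_cast
    ring_nf
  · simp [hx]

lemma integral_Ico_fourier {m : ℤ} (hm : m ≠ 0) :
    ∫ y in Ico (0 : ℝ) 1, (fourier m (y : UnitAddCircle) : ℂ) = 0 := by
  have hc : 2 * Real.pi * Complex.I * m ≠ 0 := by
    simp [Real.pi_ne_zero, hm]
  rw [integral_Ico_eq_integral_Ioc, ← intervalIntegral.integral_of_le zero_le_one]
  have : ∀ y : ℝ, (fourier m (y : UnitAddCircle) : ℂ)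
      = Complex.exp (2 * Real.pi * Complex.I * m * y) := by
    intro y; rw [fourier_coe_apply]; simp
  simp_rw [this]
  rw [integral_exp_mul_complex hc]
  have h1 : Complex.exp (2 * Real.pi * Complex.I * m * (1 : ℝ)) = 1 := by
    rw [Complex.exp_eq_one_iff]
    exact ⟨m, by push_cast; ring⟩
  rw [h1]
  simp

lemma integral_mFourier_uncurryTorus {m : Fin n × Fin d → ℤ} (hm : m ≠ 0) :
    ∫ y in unitCellPow n d, UnitAddTorus.mFourier m (uncurryTorus (toTorus y)) = 0 := by
  obtain ⟨⟨k₀, i₀⟩, hp₀⟩ := Function.ne_iff.1 hm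
  have h1 : ∀ y : Fin n → Fin d → ℝ, UnitAddTorus.mFourier m (uncurryTorus (toTorus y))
      = ∏ k, ∏ i, (fourier (m (k, i)) (y k i : UnitAddCircle) : ℂ) := by
    intro y
    simp only [UnitAddTorus.mFourier, ContinuousMap.coe_mk, uncurryTorus, toTorus]
    rw [Fintype.prod_prod_type]
  simp_rw [h1]
  rw [unitCellPow, volume_pi, Measure.restrict_pi_pi,
    integral_fintype_prod_eq_prod (fun k (z : Fin d → ℝ) =>
      ∏ i, (fourier (m (k, i)) (z i : UnitAddCircle) : ℂ))]
  refine Finset.prod_eq_zero (Finset.mem_univ k₀) ?_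
  rw [unitCell, volume_pi, Measure.restrict_pi_pi,
    integral_fintype_prod_eq_prod (fun i (z : ℝ) =>
      (fourier (m (k₀, i)) (z : UnitAddCircle) : ℂ))]
  exact Finset.prod_eq_zero (Finset.mem_univ i₀) (integral_Ico_fourier hp₀)

/-- The Lipschitz constant is the mass of P and ignores b, so the functionals along v_h are
equicontinuous in the test function and the set where convergence holds is closed. -/
lemma lipschitzWith_integral_comp {Z K : Type*} [MeasurableSpace Z] [TopologicalSpace K]
    [CompactSpace K] [MeasurableSpace K] [BorelSpace K] [SecondCountableTopology K]
    [TopologicalSpace.PseudoMetrizableSpace K] {P : Measure Z} [IsFiniteMeasure P]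
    {b : Z → K} (hb : Measurable b) :
    LipschitzWith (P.real univ).toNNReal fun G : C(K, ℂ) => ∫ z, G (b z) ∂P := by
  have hi : ∀ G : C(K, ℂ), Integrable (fun z => G (b z)) P := fun G =>
    Integrable.of_bound (G.continuous.measurable.comp hb).aestronglyMeasurable ‖G‖
      (Eventually.of_forall fun z => G.norm_coe_le_norm _)
  refine LipschitzWith.of_dist_le_mul fun G G' => ?_
  rw [dist_eq_norm, ← integral_sub (hi G) (hi G'), Real.coe_toNNReal _ measureReal_nonneg, mul_comm]
  exact norm_integral_le_of_norm_le_const (Eventually.of_forall fun z => by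
    rw [← dist_eq_norm]; exact ContinuousMap.dist_apply_le_dist _)

/-- The oscillating variables equidistribute in `Tⁿ` on every set of finite measure. -/
lemma tendsto_setIntegral_oscVar (hρ : IsScaleFamily ρ) (hεpos : ∀ h, 0 < ε h)
    (hε : Tendsto ε atTop (𝓝 0)) {s : Set (Fin d → ℝ)} (hs : MeasurableSet s)
    (hsf : volume s ≠ ∞) (G : C(UnitAddTorus (Fin n × Fin d), ℂ)) :
    Tendsto (fun h => ∫ x in s, G (uncurryTorus (toTorus (oscVar ρ ε h x)))) atTop
      (𝓝 (volume.real s • ∫ y in unitCellPow n d, G (uncurryTorus (toTorus y)))) := by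
  have hfs : IsFiniteMeasure (volume.restrict s) := ⟨by simpa using hsf.lt_top⟩
  have hfc : IsFiniteMeasure (volume.restrict (unitCellPow n d)) :=
    ⟨by simp [volume_unitCellPow]⟩
  have hbc : Measurable fun y : Fin n → Fin d → ℝ => uncurryTorus (toTorus y) :=
    (continuous_uncurryTorus.comp continuous_toTorus).measurable
  have hb : ∀ h, Measurable fun x : Fin d → ℝ => uncurryTorus (toTorus (oscVar ρ ε h x)) :=
    fun h => hbc.comp (measurable_oscVar ρ ε h)
  have hi : ∀ {Z : Type} [MeasurableSpace Z] (P : Measure Z) [IsFiniteMeasure P]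
      (b : Z → UnitAddTorus (Fin n × Fin d)), Measurable b →
      ∀ G : C(UnitAddTorus (Fin n × Fin d), ℂ), Integrable (fun z => G (b z)) P :=
    fun P _ b hb G => Integrable.of_bound
      (G.continuous.measurable.comp hb).aestronglyMeasurable ‖G‖
      (Eventually.of_forall fun z => G.norm_coe_le_norm _)
  let S : Set C(UnitAddTorus (Fin n × Fin d), ℂ) :=
    {G | Tendsto (fun h => ∫ x in s, G (uncurryTorus (toTorus (oscVar ρ ε h x)))) atTop
      (𝓝 (volume.real s • ∫ y in unitCellPow n d, G (uncurryTorus (toTorus y))))}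
  have hclosed : IsClosed S := by
    refine Equicontinuous.isClosed_setOfPred_tendsto
      (F := fun h (G : C(UnitAddTorus (Fin n × Fin d), ℂ)) =>
        ∫ x in s, G (uncurryTorus (toTorus (oscVar ρ ε h x)))) ?_ ?_
    · exact (LipschitzWith.uniformEquicontinuous _ _ fun h =>
        lipschitzWith_integral_comp (hb h)).equicontinuous
    · have hcont := (lipschitzWith_integral_comp
        (P := volume.restrict (unitCellPow n d)) hbc).continuous
      exact hcont.const_smul (volume.real s)
  have hspan : (Submodule.span ℂ (range (UnitAddTorus.mFourier (d := Fin n × Fin d))) : Set _)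
      ⊆ S := by
    intro G hG
    induction hG using Submodule.span_induction with
    | mem G hG =>
      obtain ⟨m, rfl⟩ := hG
      change Tendsto _ _ _
      rcases eq_or_ne m 0 with rfl | hm
      · simp [UnitAddTorus.mFourier_zero, Measure.real, volume_unitCellPow]
      · rw [integral_mFourier_uncurryTorus hm, smul_zero]
        exact tendsto_setIntegral_mFourier_oscVar hρ hεpos hε hm hs
    | zero => change Tendsto _ _ _; simp
    | add G G' _ _ hG hG' =>
      change Tendsto _ _ _
      have h1 := Tendsto.add (show Tendsto _ _ _ from hG) (show Tendsto _ _ _ from hG')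
      rw [← smul_add, ← integral_add (hi (volume.restrict (unitCellPow n d)) _ hbc G) (hi (volume.restrict (unitCellPow n d)) _ hbc G')] at h1
      refine h1.congr fun h => ?_
      rw [← integral_add (hi (volume.restrict s) _ (hb h) G) (hi (volume.restrict s) _ (hb h) G')]
      rfl
    | smul a G _ hG =>
      change Tendsto _ _ _
      have h1 := Tendsto.const_smul (show Tendsto _ _ _ from hG) a
      rw [smul_comm, ← integral_smul] at h1
      refine h1.congr fun h => ?_
      rw [← integral_smul]
      rfl
  have hall : closure (Submodule.span ℂ (range (UnitAddTorus.mFourier (d := Fin n × Fin d)))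
      : Set C(UnitAddTorus (Fin n × Fin d), ℂ)) ⊆ S := closure_minimal hspan hclosed
  have htop := UnitAddTorus.span_mFourier_closure_eq_top (d := Fin n × Fin d)
  have hmem : G ∈ (Submodule.span ℂ
      (range (UnitAddTorus.mFourier (d := Fin n × Fin d)))).topologicalClosure := by
    rw [htop]; trivial
  exact hall (by rwa [← Submodule.topologicalClosure_coe])

/-- Real-valued version on `Tⁿ` of the equidistribution of the oscillating variables. -/
lemma tendsto_setIntegral_oscVar_real (hρ : IsScaleFamily ρ) (hεpos : ∀ h, 0 < ε h)
    (hε : Tendsto ε atTop (𝓝 0)) {s : Set (Fin d → ℝ)} (hs : MeasurableSet s)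
    (hsf : volume s ≠ ∞) (G : C(TorusPow n d, ℝ)) :
    Tendsto (fun h => ∫ x in s, G (toTorus (oscVar ρ ε h x))) atTop
      (𝓝 (volume.real s • ∫ y in unitCellPow n d, G (toTorus y))) := by
  let G' : C(UnitAddTorus (Fin n × Fin d), ℂ) :=
    ⟨fun t => (G fun k i => t (k, i) : ℂ), by fun_prop⟩
  have hG' : ∀ t, G' (uncurryTorus t) = (G t : ℂ) := fun _ => rfl
  have h := tendsto_setIntegral_oscVar hρ hεpos hε hs hsf G'
  simp only [hG', integral_complex_ofReal] at h
  have h1 := (Complex.continuous_re.tendsto _).comp h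
  simpa [Function.comp_def] using h1

end Equidistribution

/-! ### From indicator functions to L¹(Ω, C(Tⁿ)). -/

section EvaluationAlongMeasures

variable {n d : ℕ} {Ω : Set (Fin d → ℝ)} {P : Measure ((Fin d → ℝ) × (Fin n → Fin d → ℝ))}

lemma integrable_eval_toTorus (hP : MeasurePreserving Prod.fst P (volume.restrict Ω))
    {c : (Fin d → ℝ) → C(TorusPow n d, ℝ)} (hc : IntegrableOn c Ω) :
    Integrable (fun p => c p.1 (toTorus p.2)) P := by
  have h1 : Integrable (fun p : (Fin d → ℝ) × (Fin n → Fin d → ℝ) => ‖c p.1‖) P :=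
    hP.integrable_comp_of_integrable hc.norm
  have h2 : Continuous fun r : C(TorusPow n d, ℝ) × TorusPow n d => r.1 r.2 := by fun_prop
  have h3 : AEStronglyMeasurable
      (fun p : (Fin d → ℝ) × (Fin n → Fin d → ℝ) => (c p.1, toTorus p.2)) P :=
    (hc.1.comp_measurePreserving hP).prodMk
      (measurable_toTorus.comp measurable_snd).aestronglyMeasurable
  exact h1.mono' (h2.comp_aestronglyMeasurable h3)
    (Eventually.of_forall fun p => (c p.1).norm_coe_le_norm _)

lemma integral_eval_toTorus_congr (hP : MeasurePreserving Prod.fst P (volume.restrict Ω))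
    {c c' : (Fin d → ℝ) → C(TorusPow n d, ℝ)} (hcc' : c =ᵐ[volume.restrict Ω] c') :
    ∫ p, c p.1 (toTorus p.2) ∂P = ∫ p, c' p.1 (toTorus p.2) ∂P := by
  refine integral_congr_ae ?_
  filter_upwards [hP.quasiMeasurePreserving.ae hcc'] with p hp
  rw [hp]

/-- The sup norm of c(x) - c'(x) dominates the integrand, and its integral depends only on the first
marginal of P; the constant 1 thus serves all graph measures and their limit. -/
lemma lipschitzWith_integral_eval (hP : MeasurePreserving Prod.fst P (volume.restrict Ω)) :
    LipschitzWith 1 fun c : (Fin d → ℝ) →₁[volume.restrict Ω] C(TorusPow n d, ℝ) =>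
      ∫ p, c p.1 (toTorus p.2) ∂P := by
  refine LipschitzWith.of_dist_le_mul fun c c' => ?_
  have hc := L1.integrable_coeFn c
  have hc' := L1.integrable_coeFn c'
  rw [NNReal.coe_one, one_mul, L1.dist_eq_integral_dist, dist_eq_norm,
    ← integral_sub (integrable_eval_toTorus hP hc) (integrable_eval_toTorus hP hc')]
  simp only [dist_eq_norm]
  calc ‖∫ p, (c p.1 (toTorus p.2) - c' p.1 (toTorus p.2)) ∂P‖
      ≤ ∫ p, ‖c p.1 - c' p.1‖ ∂P := by
        refine norm_integral_le_of_norm_le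
          (hP.integrable_comp_of_integrable (hc.sub hc').norm)
          (Eventually.of_forall fun p => ?_)
        exact (c p.1 - c' p.1).norm_coe_le_norm _
    _ = ∫ x in Ω, ‖c x - c' x‖ := by
        have h := integral_map hP.aemeasurable (f := fun x => ‖c x - c' x‖)
          (by rw [hP.map_eq]; exact (hc.sub hc').1.norm)
        rw [← h, hP.map_eq]

/-- Convergence on indicator functions with values in `C(Tⁿ)` implies convergence on `L¹`. -/
lemma tendsto_integral_eval_of_indicator {Ps : ℕ → Measure ((Fin d → ℝ) × (Fin n → Fin d → ℝ))}
    (hPs : ∀ h, MeasurePreserving Prod.fst (Ps h) (volume.restrict Ω))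
    (hP : MeasurePreserving Prod.fst P (volume.restrict Ω))
    (hind : ∀ (G : C(TorusPow n d, ℝ)) (s : Set (Fin d → ℝ)), MeasurableSet s →
      Tendsto (fun h => ∫ p, s.indicator (fun _ => G) p.1 (toTorus p.2) ∂(Ps h)) atTop
        (𝓝 (∫ p, s.indicator (fun _ => G) p.1 (toTorus p.2) ∂P)))
    {c : (Fin d → ℝ) → C(TorusPow n d, ℝ)} (hc : IntegrableOn c Ω) :
    Tendsto (fun h => ∫ p, c p.1 (toTorus p.2) ∂(Ps h)) atTop
      (𝓝 (∫ p, c p.1 (toTorus p.2) ∂P)) := by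
  refine Integrable.induction (μ := volume.restrict Ω)
    (fun c : (Fin d → ℝ) → C(TorusPow n d, ℝ) =>
      Tendsto (fun h => ∫ p, c p.1 (toTorus p.2) ∂(Ps h)) atTop
        (𝓝 (∫ p, c p.1 (toTorus p.2) ∂P))) ?_ ?_ ?_ ?_ hc
  · intro G s hs _
    exact hind G s hs
  · intro f g _ hf hg hf' hg'
    have h1 := hf'.add hg'
    rw [← integral_add (integrable_eval_toTorus hP hf) (integrable_eval_toTorus hP hg)] at h1
    refine h1.congr fun h => ?_
    rw [← integral_add (integrable_eval_toTorus (hPs h) hf) (integrable_eval_toTorus (hPs h) hg)]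
    rfl
  · refine Equicontinuous.isClosed_setOfPred_tendsto
      (F := fun h (c : (Fin d → ℝ) →₁[volume.restrict Ω] C(TorusPow n d, ℝ)) =>
        ∫ p, c p.1 (toTorus p.2) ∂(Ps h)) ?_ (lipschitzWith_integral_eval hP).continuous
    exact (LipschitzWith.uniformEquicontinuous _ _ fun h =>
      lipschitzWith_integral_eval (hPs h)).equicontinuous
  · intro f g hfg _ hf
    rw [← integral_eval_toTorus_congr hP hfg]
    exact hf.congr fun h => integral_eval_toTorus_congr (hPs h) hfg

end EvaluationAlongMeasures

/-! ### The constant sequence and (b). -/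

section ConstantSequence

variable {n d : ℕ} {Ω : Set (Fin d → ℝ)} {ρ : Fin n → ℝ → ℝ} {ε : ℕ → ℝ}

lemma macroMicro_eq_prod (n : ℕ) (Ω : Set (Fin d → ℝ)) :
    macroMicro n Ω = (volume.restrict Ω).prod (volume.restrict (unitCellPow n d)) := by
  rw [macroMicro, Measure.volume_eq_prod, Measure.prod_restrict]

instance isProbabilityMeasure_restrict_unitCellPow (n d : ℕ) :
    IsProbabilityMeasure (volume.restrict (unitCellPow n d)) :=
  ⟨by simp [volume_unitCellPow]⟩

lemma measurePreserving_fst_macroMicro (n : ℕ) (Ω : Set (Fin d → ℝ)) :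
    MeasurePreserving Prod.fst (macroMicro n Ω) (volume.restrict Ω) := by
  rw [macroMicro_eq_prod]
  exact measurePreserving_fst

lemma tendsto_integral_eval_oscVar (hΩ : MeasurableSet Ω) (hΩf : volume Ω ≠ ∞)
    (hρ : IsScaleFamily ρ) (hεpos : ∀ h, 0 < ε h) (hε : Tendsto ε atTop (𝓝 0))
    {c : (Fin d → ℝ) → C(TorusPow n d, ℝ)} (hc : IntegrableOn c Ω) :
    Tendsto (fun h => ∫ x in Ω, c x (toTorus (oscVar ρ ε h x))) atTop
      (𝓝 (∫ p, c p.1 (toTorus p.2) ∂(macroMicro n Ω))) := by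
  have hfin : IsFiniteMeasure (volume.restrict Ω) := ⟨by simpa using hΩf.lt_top⟩
  have hW : ∀ h, Measurable fun x : Fin d → ℝ => (x, oscVar ρ ε h x) := fun h =>
    measurable_id.prodMk (measurable_oscVar ρ ε h)
  let Ps : ℕ → Measure ((Fin d → ℝ) × (Fin n → Fin d → ℝ)) := fun h =>
    (volume.restrict Ω).map fun x => (x, oscVar ρ ε h x)
  have hPs : ∀ h, MeasurePreserving Prod.fst (Ps h) (volume.restrict Ω) := by
    intro h
    refine ⟨measurable_fst, ?_⟩
    rw [Measure.map_map measurable_fst (hW h)]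
    exact Measure.map_id
  have hmap : ∀ h (c : (Fin d → ℝ) → C(TorusPow n d, ℝ)), IntegrableOn c Ω →
      ∫ p, c p.1 (toTorus p.2) ∂(Ps h) = ∫ x in Ω, c x (toTorus (oscVar ρ ε h x)) :=
    fun h c hc => integral_map (hW h).aemeasurable (integrable_eval_toTorus (hPs h) hc).1
  refine (tendsto_integral_eval_of_indicator hPs (measurePreserving_fst_macroMicro n Ω)
    (fun G s hs => ?_) hc).congr fun h => hmap h c hc
  have hval : ∀ x t, s.indicator (fun _ => G) x t = s.indicator (fun _ => (1 : ℝ)) x * G t := by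
    intro x t
    by_cases hx : x ∈ s <;> simp [hx]
  have hlim := tendsto_setIntegral_oscVar_real hρ hεpos hε (hs.inter hΩ)
    ((measure_mono inter_subset_right).trans_lt hΩf.lt_top).ne G
  have heq : ∫ p, s.indicator (fun _ => G) p.1 (toTorus p.2) ∂(macroMicro n Ω)
      = volume.real (s ∩ Ω) • ∫ y in unitCellPow n d, G (toTorus y) := by
    simp_rw [hval]
    rw [macroMicro_eq_prod, integral_prod_mul (s.indicator fun _ => (1 : ℝ))
      (fun y => G (toTorus y)), integral_indicator hs, Measure.restrict_restrict hs]
    simp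
  rw [heq]
  refine hlim.congr fun h => ?_
  rw [hmap h _ ((integrable_const G).indicator hs), ← Measure.restrict_restrict hs,
    ← integral_indicator hs]
  refine integral_congr_ae (Eventually.of_forall fun x => ?_)
  by_cases hx : x ∈ s <;> simp [hx]

/-- The constant sequence `1` generates the Dirac mass at `1` as its multiscale Young measure. -/
theorem generatesMultiscaleYoungMeasure_one (hΩ : MeasurableSet Ω) (hΩf : volume Ω ≠ ∞)
    (hρ : IsScaleFamily ρ) (hεpos : ∀ h, 0 < ε h) (hε : Tendsto ε atTop (𝓝 0)) :
    GeneratesMultiscaleYoungMeasure (n := n) Ω ρ ε (fun _ _ => 1)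
      (fun _ => Measure.dirac (1 : ℝ)) := by
  have ht : Measurable fun y : Fin n → Fin d → ℝ => ((toTorus y, 1) : TorusPow n d × ℝ) :=
    measurable_toTorus.prodMk measurable_const
  -- The generated Young measure is constant in x: the law of (y, 1) with y uniform on □ⁿ.
  let μ₀ : Measure (TorusPow n d × ℝ) :=
    (volume.restrict (unitCellPow n d)).map fun y => (toTorus y, 1)
  have hμ₀ : IsProbabilityMeasure μ₀ := Measure.isProbabilityMeasure_map ht.aemeasurable
  refine ⟨⟨fun φ => aemeasurable_const, Eventually.of_forall fun _ => inferInstance⟩,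
    fun _ => μ₀, ⟨⟨fun φ => aemeasurable_const, Eventually.of_forall fun _ => hμ₀⟩, ?_⟩, ?_⟩
  · intro Φ hΦ
    -- Restriction to the slice z = 1 turns a test function Φ into an element of L¹(Ω, C(Tⁿ)), to
    -- which equidistribution applies.
    let R : C₀(TorusPow n d × ℝ, ℝ) →L[ℝ] C(TorusPow n d, ℝ) :=
      LinearMap.mkContinuous
        { toFun := fun φ => ⟨fun t => φ (t, 1), by fun_prop⟩
          map_add' := fun _ _ => rfl
          map_smul' := fun _ _ => rfl } 1 fun φ => by
        rw [one_mul, ContinuousMap.norm_le _ (norm_nonneg _)]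
        intro t
        rw [← ZeroAtInftyContinuousMap.norm_toBCF_eq_norm]
        exact φ.toBCF.norm_coe_le_norm (t, 1)
    have hc : IntegrableOn (fun x => R (Φ x)) Ω := R.integrable_comp hΦ
    have hlim := tendsto_integral_eval_oscVar hΩ hΩf hρ hεpos hε hc
    have hint := integrable_eval_toTorus (measurePreserving_fst_macroMicro n Ω) hc
    have heq : ∫ p, R (Φ p.1) (toTorus p.2) ∂(macroMicro n Ω)
        = ∫ x in Ω, ∫ s, Φ x s ∂μ₀ := by
      rw [macroMicro_eq_prod] at hint ⊢
      rw [integral_prod _ hint]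
      refine integral_congr_ae (Eventually.of_forall fun x => ?_)
      simp only [μ₀]
      exact (integral_map ht.aemeasurable
        (Φ x).toContinuousMap.continuous.aestronglyMeasurable).symm
    rw [heq] at hlim
    exact hlim
  · intro A hA
    have hτ : Measurable fun p : (Fin d → ℝ) × (Fin n → Fin d → ℝ) =>
        ((p.1, (toTorus p.2, 1)) : (Fin d → ℝ) × (TorusPow n d × ℝ)) :=
      measurable_fst.prodMk (ht.comp measurable_snd)
    have hright : youngHat (macroMicro n Ω) (fun _ => Measure.dirac (1 : ℝ))
        {p | (p.1.1, (toTorus p.1.2, p.2)) ∈ A}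
        = ∫⁻ p, A.indicator 1 (p.1, (toTorus p.2, (1 : ℝ))) ∂(macroMicro n Ω) := by
      refine lintegral_congr fun p => ?_
      have hm : MeasurableSet {s : ℝ | (p.1, (toTorus p.2, s)) ∈ A} :=
        (measurable_const.prodMk (measurable_const.prodMk measurable_id)) hA
      change Measure.dirac (1 : ℝ) {s : ℝ | (p.1, (toTorus p.2, s)) ∈ A} = _
      rw [Measure.dirac_apply' _ hm]
      rfl
    have hind : Measurable fun p : (Fin d → ℝ) × (Fin n → Fin d → ℝ) =>
        A.indicator (1 : (Fin d → ℝ) × (TorusPow n d × ℝ) → ℝ≥0∞) (p.1, (toTorus p.2, (1 : ℝ))) :=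
      (measurable_one.indicator hA).comp hτ
    rw [hright, macroMicro_eq_prod, lintegral_prod _ hind.aemeasurable]
    refine lintegral_congr fun x => ?_
    have hm : MeasurableSet {s : TorusPow n d × ℝ | (x, s) ∈ A} := measurable_prodMk_left hA
    simp only [μ₀]
    rw [Measure.map_apply ht hm, ← lintegral_indicator_one (ht hm)]
    rfl

end ConstantSequence

end MultiscaleYoungMeasures

theorem theorem4p1 (d n : ℕ) (hd : 0 < d) (hn : 0 < n)
    (Ω : Set (Fin d → ℝ)) (hΩ : IsOpen Ω) (hΩb : Bornology.IsBounded Ω)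
    (ρ : Fin n → ℝ → ℝ) (hρ : IsScaleFamily ρ)
    (ε : ℕ → ℝ) (hεpos : ∀ h, 0 < ε h) (hε : Tendsto ε atTop (𝓝 0)) :
    (∀ (q q' : ℝ≥0∞), 1 < q → q.HolderConjugate q' →
      ∀ u : ℕ → (Fin d → ℝ) → ℝ,
      (∀ h, MemLp (u h) q (volume.restrict Ω)) →
      (∃ C : ℝ≥0∞, C ≠ ∞ ∧ ∀ h, eLpNorm (u h) q (volume.restrict Ω) ≤ C) →
      ∀ ν : (Fin d → ℝ) × (Fin n → Fin d → ℝ) → Measure ℝ,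
      GeneratesMultiscaleYoungMeasure Ω ρ ε u ν →
      ∀ ψ : (Fin d → ℝ) → (Fin n → Fin d → ℝ) → ℝ, IsAdm q' Ω ψ →
        (∀ h, IntegrableOn (fun x => ψ x (oscVar ρ ε h x) * u h x) Ω) ∧
        (∀ᵐ p ∂(macroMicro n Ω), Integrable (fun z : ℝ => z) (ν p)) ∧
        Integrable (fun p => ψ p.1 p.2 * barycenter ν p) (macroMicro n Ω) ∧
        Tendsto (fun h => ∫ x in Ω, ψ x (oscVar ρ ε h x) * u h x) atTop
          (𝓝 (∫ p, ψ p.1 p.2 * barycenter ν p ∂(macroMicro n Ω)))) ∧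
    (∀ r : ℝ≥0∞, 1 ≤ r →
      ∀ ψ : (Fin d → ℝ) → (Fin n → Fin d → ℝ) → ℝ, IsAdm r Ω ψ →
        (∀ h, IntegrableOn (fun x => ψ x (oscVar ρ ε h x)) Ω) ∧
        Integrable (fun p => ψ p.1 p.2) (macroMicro n Ω) ∧
        Tendsto (fun h => ∫ x in Ω, ψ x (oscVar ρ ε h x)) atTop
          (𝓝 (∫ p, ψ p.1 p.2 ∂(macroMicro n Ω)))) := by
  refine ⟨fun q q' hq hqq' u hu huB ν hν ψ hψ =>
    hν.mean_value hΩ hΩb hρ hεpos hε hq hqq' hu huB hψ, fun r hr ψ hψ => ?_⟩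
  have hΩf : volume Ω ≠ ∞ := hΩb.measure_lt_top.ne
  have hfin : IsFiniteMeasure (volume.restrict Ω) := ⟨by simpa using hΩf.lt_top⟩
  obtain ⟨hadm, α, hα, hα0, hαψ⟩ := hψ
  -- Ω has finite measure, so r ≥ 1 may be lowered to 1, the exponent conjugate to q = ∞.
  have hψ1 : IsAdm 1 Ω ψ := ⟨hadm, α, hα.mono_exponent hr, hα0, hαψ⟩
  have hone : MemLp (fun _ : Fin d → ℝ => (1 : ℝ)) ∞ (volume.restrict Ω) := memLp_const 1
  have h := (generatesMultiscaleYoungMeasure_one hΩ.measurableSet hΩf hρ hεpos hε).mean_value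
    hΩ hΩb hρ hεpos hε ENNReal.one_lt_top ENNReal.HolderConjugate.top_one
    (fun _ => hone) ⟨_, hone.eLpNorm_ne_top, fun _ => le_rfl⟩ hψ1
  simp only [barycenter, integral_dirac, mul_one] at h
  exact ⟨h.1, h.2.2.1, h.2.2.2⟩
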